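/- Let $\mathcal H_0=\mathbb C^{K+1}$ and let $\mathcal H=\mathbb C^{N+1}$ with orthonormal basis $X_0,\dots,X_N$. For each $n\ge 1$ let $U(n)$ be a unitary operator on $\mathcal H_0\otimes\mathcal H$ with blocks $U_{ij}(n)$ (operators on $\mathcal H_0$, $0\le i,j\le N$), and suppose that there are operators $L_{00},\dots,L_{N0}$ on $\mathcal H_0$ with $$n\,(U_{00}(n)-I)\to L_{00},\qquad \sqrt n\,U_{i0}(n)\to L_{i0}\quad(1\le i\le N)\qquad (n\to\infty).$$ Let $A=\sum_{i=0}^p\lambda_iP_i$ be the spectral decomposition of an observable $A$ on $\mathcal H$ (distinct real eigenvalues $\lambda_i$, eigen-projectors $P_i$), and let $\beta=|X_0\rangle\langle X_0|$. For a state $\rho_0$ on $\mathcal H_0$ (a positive semidefinite operator of trace one) and $n\ge1$, consider the repeated quantum measurements of $A$: copies $\mathcal H_1,\mathcal H_2,\dots$ of $\mathcal H$, each in the state $\beta$, interact one after the other with $\mathcal H_0$ through $U(n)$ (write $U_j$ for $U(n)$ acting on $\mathcal H_0\otimes\mathcal H_j$, and $P^j_i$ for $P_i$ acting on $\mathcal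 H_j$), and $A$ is measured on the $j$-th copy after the $j$-th interaction. With $V_k=U_k\cdots U_1$ and $$\tilde\mu(i_1,\dots,i_k)=P^k_{i_k}\cdots P^1_{i_1}\,V_k\,(\rho_0\otimes\beta^{\otimes k})\,V_k^\star\,P^1_{i_1}\cdots P^k_{i_k},$$ let $\mathbf P^{(n)}$ be the probability measure on $\{0,\dots,p\}^{\mathbb N^\star}$ under which the first $k$ outcomes are $i_1,\dots,i_k$ with probability $\mathrm{Tr}[\tilde\mu(i_1,\dots,i_k)]$, for all $k$ and $i_1,\dots,i_k$. Let $\rho_k(\omega)$ be the partial trace on $\mathcal H_0$ of $\tilde\mu(\omega_1,\dots,\omega_k)/\mathrm{Tr}[\tilde\mu(\omega_1,\dots,\omega_k)]$, and let $\rho_n(t)=\rho_{\lfloor nt\rfloor}$ for $t\ge0$. Then there is a constant $Z$, which depends neither on $n$, nor on the times, nor on $\rho_0$, such that for every state $\rho_0$, all $n\ge1$ and all $0\le t_1<t<t_2$, $$\mathbf E\big[\|\rho_n(t_2)-\rho_n(t)\|^2\,\|\rho_n(t)-\rho_n(t_1)\|^2\big]\le Z\,(t_2-t_1)^2,$$ where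 $\|\cdot\|$ is the Hilbert–Schmidt norm. Moreover, for every state $\rho_0$, the sequence of processes $(\rho_n(t))_{t\ge0}$, $n\ge1$, is tight: the laws of these processes on the Skorokhod space $D([0,\infty))$ of càdlàg functions with values in the operators on $\mathcal H_0$ form a tight family. -/

import Mathlib

open Filter Topology MeasureTheory
open scoped NNReal ENNReal Matrix Kronecker ComplexOrder Matrix.Norms.Frobenius

namespace QTraj

section Skorokhod

/-- Càdlàg functions from `[0, ∞)` to `E`: right-continuous with left limits. -/
structure CadlagPath (E : Type*) [PseudoMetricSpace E] where
  /-- the underlying function -/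
  toFun : ℝ≥0 → E
  right_cont : ∀ t, ContinuousWithinAt toFun (Set.Ici t) t
  left_lim : ∀ t, ∃ l, Tendsto toFun (𝓝[<] t) (𝓝 l)

variable {E : Type*} [PseudoMetricSpace E]

/-- The pairs `(x, y)` of paths for which some time change `τ` (an increasing bijection of
`[0, ∞)`) satisfies `|τ t - t| < ε` and `dist (y t) (x (τ t)) < ε` for all `t ≤ T`. -/
def skorokhodEntourage (E : Type*) [PseudoMetricSpace E] (T : ℝ≥0) (ε : ℝ) :
    Set (CadlagPath E × CadlagPath E) :=
  {q | ∃ τ : ℝ≥0 ≃o ℝ≥0, ∀ t ≤ T, dist (τ t) t < ε ∧ dist (q.2.toFun t) (q.1.toFun (τ t)) < ε}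

theorem skorokhodEntourage_mono {T T' : ℝ≥0} {ε ε' : ℝ} (hT : T' ≤ T) (hε : ε ≤ ε') :
    skorokhodEntourage E T ε ⊆ skorokhodEntourage E T' ε' := by
  rintro q ⟨τ, h⟩
  exact ⟨τ, fun t ht => ⟨(h t (ht.trans hT)).1.trans_le hε, (h t (ht.trans hT)).2.trans_le hε⟩⟩

/-- The entourages of the Skorokhod (J1) uniformity form a filter basis. -/
def skorokhodBasis (E : Type*) [PseudoMetricSpace E] :
    FilterBasis (CadlagPath E × CadlagPath E) where
  sets := {S | ∃ (T : ℝ≥0) (ε : ℝ), 0 < ε ∧ S = skorokhodEntourage E T ε}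
  nonempty := ⟨_, 0, 1, one_pos, rfl⟩
  inter_sets := by
    rintro _ _ ⟨T, ε, hε, rfl⟩ ⟨T', ε', hε', rfl⟩
    exact ⟨_, ⟨max T T', min ε ε', lt_min hε hε', rfl⟩, Set.subset_inter
      (skorokhodEntourage_mono (le_max_left _ _) (min_le_left _ _))
      (skorokhodEntourage_mono (le_max_right _ _) (min_le_right _ _))⟩

/-- The Skorokhod (J1) topology on the space of càdlàg paths on `[0, ∞)`, given by a uniformity:
`x_m → x` means that for every `T` there are time changes `τ_m` with
`sup_{t ≤ T} |τ_m t - t| → 0` and `sup_{t ≤ T} dist (x_m t) (x (τ_m t)) → 0`. -/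
instance (E : Type*) [PseudoMetricSpace E] : UniformSpace (CadlagPath E) :=
  UniformSpace.ofCore <| UniformSpace.Core.mkOfBasis (skorokhodBasis E)
    (by
      rintro _ ⟨T, ε, hε, rfl⟩ x
      exact ⟨OrderIso.refl _, fun t _ => by simpa using hε⟩)
    (by
      rintro _ ⟨T, ε, hε, rfl⟩
      refine ⟨_, ⟨T + 1, min ε 1, lt_min hε one_pos, rfl⟩, ?_⟩
      rintro ⟨x, y⟩ ⟨τ, h⟩
      refine ⟨τ.symm, fun t ht => ?_⟩
      have key : τ.symm t ≤ T + 1 := by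
        by_contra hlt
        push Not at hlt
        have h1 : T + 1 < t + 1 := by
          have h2 : τ (T + 1) < t := by
            have := τ.strictMono hlt
            rwa [OrderIso.apply_symm_apply] at this
          have h3 := (h (T + 1) le_rfl).1.trans_le (min_le_right _ _)
          rw [NNReal.dist_eq, abs_lt] at h3
          rw [← NNReal.coe_lt_coe] at h2 ⊢
          push_cast at h2 h3 ⊢
          linarith [h3.1]
        exact absurd ht (not_le.2 (lt_of_add_lt_add_right h1))
      obtain ⟨h1, h2⟩ := h _ key
      rw [OrderIso.apply_symm_apply] at h1 h2
      refine ⟨?_, ?_⟩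
      · rw [dist_comm]; exact h1.trans_le (min_le_left _ _)
      · change dist (x.toFun t) (y.toFun (τ.symm t)) < ε
        rw [dist_comm]; exact h2.trans_le (min_le_left _ _))
    (by
      rintro _ ⟨T, ε, hε, rfl⟩
      refine ⟨_, ⟨T + 1, min (ε / 2) 1, lt_min (half_pos hε) one_pos, rfl⟩, ?_⟩
      rintro ⟨x, z⟩ ⟨y, ⟨τ, h⟩, ⟨σ, h'⟩⟩
      refine ⟨σ.trans τ, fun t ht => ?_⟩
      obtain ⟨a1, a2⟩ := h' t (ht.trans (le_add_of_nonneg_right zero_le_one))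
      have key : σ t ≤ T + 1 := by
        have a3 := a1.trans_le (min_le_right _ _)
        rw [NNReal.dist_eq, abs_lt] at a3
        rw [← NNReal.coe_le_coe] at ht ⊢
        push_cast
        linarith [a3.2]
      obtain ⟨b1, b2⟩ := h _ key
      have hm := min_le_left (ε / 2) 1
      refine ⟨?_, ?_⟩
      · have := dist_triangle (τ (σ t)) (σ t) t
        change dist (τ (σ t)) t < ε
        linarith
      · have := dist_triangle (z.toFun t) (y.toFun (σ t)) (x.toFun (τ (σ t)))
        change dist (z.toFun t) (x.toFun (τ (σ t))) < ε
        change dist (y.toFun (σ t)) (x.toFun (τ (σ t))) < _ at b2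
        change dist (z.toFun t) (y.toFun (σ t)) < _ at a2
        linarith)

/-- Basic neighbourhoods in the Skorokhod topology. -/
theorem hasBasis_nhds_cadlagPath (x : CadlagPath E) :
    (𝓝 x).HasBasis (fun q : ℝ≥0 × ℝ => 0 < q.2) (fun q => {y | ∃ τ : ℝ≥0 ≃o ℝ≥0, ∀ t ≤ q.1,
      dist (τ t) t < q.2 ∧ dist (y.toFun t) (x.toFun (τ t)) < q.2}) := by
  have h : (uniformity (CadlagPath E)).HasBasis (fun q : ℝ≥0 × ℝ => 0 < q.2)
      (fun q => skorokhodEntourage E q.1 q.2) := by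
    refine ⟨fun S => ((skorokhodBasis E).mem_filter_iff).trans ⟨?_, ?_⟩⟩
    · rintro ⟨_, ⟨T, ε, hε, rfl⟩, hS⟩
      exact ⟨(T, ε), hε, hS⟩
    · rintro ⟨⟨T, ε⟩, hε, hS⟩
      exact ⟨_, ⟨T, ε, hε, rfl⟩, hS⟩
  exact nhds_basis_uniformity' h

instance (E : Type*) [PseudoMetricSpace E] : MeasurableSpace (CadlagPath E) := borel _

instance (E : Type*) [PseudoMetricSpace E] : BorelSpace (CadlagPath E) := ⟨rfl⟩

/-- The step path `t ↦ x_[n t]` attached to a sequence `x`. -/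
noncomputable def stepPath {E : Type*} [PseudoMetricSpace E] (n : ℕ) (x : ℕ → E) : CadlagPath E where
  toFun t := x ⌊(n : ℝ≥0) * t⌋₊
  right_cont t := by
    refine tendsto_nhds_of_eventually_eq ?_
    have hc : Tendsto (fun s : ℝ≥0 => (n : ℝ≥0) * s) (𝓝[≥] t) (𝓝[≥] ((n : ℝ≥0) * t)) :=
      tendsto_nhdsWithin_iff.2 ⟨((continuous_const_mul _).tendsto t).mono_left nhdsWithin_le_nhds,
        eventually_nhdsWithin_of_forall fun s hs => by
          simp only [Set.mem_Ici] at hs ⊢; gcongr⟩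
    have h := hc.eventually (Ico_mem_nhdsGE (Nat.lt_floor_add_one ((n : ℝ≥0) * t)))
    filter_upwards [h] with s hs
    congr 1
    refine (Nat.floor_eq_iff zero_le).2 ⟨(Nat.floor_le zero_le).trans hs.1, hs.2⟩
  left_lim t := by
    rcases Nat.eq_zero_or_pos (⌈(n : ℝ≥0) * t⌉₊) with h0 | h0
    · have h1 : (n : ℝ≥0) * t = 0 := by simpa using h0
      rcases mul_eq_zero.1 h1 with h2 | h2
      · exact ⟨x 0, by simpa [h2] using tendsto_const_nhds⟩
      · refine ⟨x 0, ?_⟩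
        have : Set.Iio (0 : ℝ≥0) = ∅ := by ext; simp
        rw [h2, this]; simp
    · refine ⟨x (⌈(n : ℝ≥0) * t⌉₊ - 1), tendsto_nhds_of_eventually_eq ?_⟩
      have hlt : ((⌈(n : ℝ≥0) * t⌉₊ - 1 : ℕ) : ℝ≥0) < (n : ℝ≥0) * t :=
        Nat.lt_ceil.1 (Nat.sub_lt h0 one_pos)
      have hn : 0 < (n : ℝ≥0) := by
        rcases eq_or_ne (n : ℝ≥0) 0 with h | h
        · rw [h] at h0; simp at h0
        · exact pos_iff_ne_zero.2 h
      have hev : ∀ᶠ s in 𝓝[<] t, ((⌈(n : ℝ≥0) * t⌉₊ - 1 : ℕ) : ℝ≥0) < (n : ℝ≥0) * s :=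
        (((continuous_const_mul (n : ℝ≥0)).tendsto t).mono_left nhdsWithin_le_nhds).eventually
          (lt_mem_nhds hlt)
      filter_upwards [hev, self_mem_nhdsWithin] with s h1 h2
      congr 1
      refine (Nat.floor_eq_iff zero_le).2 ⟨h1.le, ?_⟩
      have h3 : (n : ℝ≥0) * s < (n : ℝ≥0) * t := mul_lt_mul_of_pos_left h2 hn
      refine h3.trans_le ((Nat.le_ceil _).trans (le_of_eq ?_))
      rw [← Nat.cast_add_one, Nat.sub_add_cancel h0]

end Skorokhod

section Quantum

variable {d e ι : Type*} [Fintype d] [DecidableEq d] [Fintype e] [DecidableEq e]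

/-- Density matrices: positive semidefinite of trace one. -/
def IsState {c : Type*} [Fintype c] (ρ : Matrix c c ℂ) : Prop :=
  ρ.PosSemidef ∧ ρ.trace = 1

/-- `A = ∑ i, lam i • P i` is the spectral decomposition of the observable `A`: the `lam i` are its
distinct (real) eigenvalues and the `P i` are the corresponding eigen-projectors. -/
structure IsSpectralDecomposition [Fintype ι] (A : Matrix e e ℂ) (lam : ι → ℝ)
    (P : ι → Matrix e e ℂ) : Prop where
  eigenvalues_distinct : Function.Injective lam
  hermitian : ∀ i, (P i).IsHermitian
  idempotent : ∀ i, P i * P i = P i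
  orthogonal : ∀ i j, i ≠ j → P i * P j = 0
  ne_zero : ∀ i, P i ≠ 0
  sum_eq_one : ∑ i, P i = 1
  eq_sum : A = ∑ i, (lam i : ℂ) • P i

/-- The ampliation to `H₀ ⊗ H^{⊗ k}` of an operator `M` on `H₀ ⊗ H`: it acts as `M` on `H₀` and the
`j`-th copy of `H`, and as the identity on the other copies. The standard basis of
`H₀ ⊗ H^{⊗ k}` is indexed by `d × (Fin k → e)`. -/
def ampliation {k : ℕ} (j : Fin k) (M : Matrix (d × e) (d × e) ℂ) :
    Matrix (d × (Fin k → e)) (d × (Fin k → e)) ℂ :=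
  Matrix.of fun x y => if ∀ i, i ≠ j → x.2 i = y.2 i then M (x.1, x.2 j) (y.1, y.2 j) else 0

/-- The projector `P` on `H`, ampliated to the `j`-th copy of `H` in `H₀ ⊗ H^{⊗ k}`. -/
def ampliatedProjector {k : ℕ} (j : Fin k) (P : Matrix e e ℂ) :
    Matrix (d × (Fin k → e)) (d × (Fin k → e)) ℂ :=
  ampliation j ((1 : Matrix d d ℂ) ⊗ₖ P)

/-- `V_k = U_k ⋯ U_1`, where `U_j` is the interaction `U` between `H₀` and the `j`-th copy. -/
def evolution (U : Matrix (d × e) (d × e) ℂ) (k : ℕ) :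
    Matrix (d × (Fin k → e)) (d × (Fin k → e)) ℂ :=
  (List.ofFn fun j : Fin k => ampliation j U).reverse.prod

/-- The initial state `ρ ⊗ β ⊗ ⋯ ⊗ β` on `H₀ ⊗ H^{⊗ k}`. -/
def initialState (β : Matrix e e ℂ) (ρ : Matrix d d ℂ) (k : ℕ) :
    Matrix (d × (Fin k → e)) (d × (Fin k → e)) ℂ :=
  Matrix.of fun x y => ρ x.1 y.1 * ∏ j, β (x.2 j) (y.2 j)

/-- The non-normalized state
`(P^k_{i_k} ⋯ P^1_{i_1}) (V_k (ρ ⊗ β ⊗ ⋯ ⊗ β) V_k⋆) (P^1_{i_1} ⋯ P^k_{i_k})`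
after the first `k` interactions and measurements with outcomes `i_1, …, i_k`. -/
def unnormalizedState (U : Matrix (d × e) (d × e) ℂ) (β : Matrix e e ℂ) (P : ι → Matrix e e ℂ)
    (ρ : Matrix d d ℂ) {k : ℕ} (i : Fin k → ι) :
    Matrix (d × (Fin k → e)) (d × (Fin k → e)) ℂ :=
  (List.ofFn fun j => ampliatedProjector j (P (i j))).reverse.prod *
    (evolution U k * initialState β ρ k * (evolution U k)ᴴ) *
    (List.ofFn fun j => ampliatedProjector j (P (i j))).prod

/-- `Q` is the law of the sequence of outcomes of the repeated measurements started from `ρ`: the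
outcomes `i_1, …, i_k` are observed with probability `Tr [unnormalizedState i]`. The `j`-th
outcome is `ω (j - 1)`. The case `k = 0` says that `Q` has total mass `Tr ρ = 1`. -/
def IsOutcomeLaw [MeasurableSpace ι] (U : Matrix (d × e) (d × e) ℂ) (β : Matrix e e ℂ)
    (P : ι → Matrix e e ℂ) (ρ : Matrix d d ℂ) (Q : Measure (ℕ → ι)) : Prop :=
  ∀ (k : ℕ) (i : Fin k → ι), Q {ω | ∀ j : Fin k, ω j = i j} =
    ENNReal.ofReal (unnormalizedState U β P ρ i).trace.re

/-- The partial trace over the second factor. -/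
def partialTrace {c : Type*} [Fintype c] (W : Matrix (d × c) (d × c) ℂ) : Matrix d d ℂ :=
  Matrix.of fun a b => ∑ x, W (a, x) (b, x)

/-- The discrete quantum trajectory `ρ_k(ω)` on `H₀`: the partial trace over the copies of `H` of
the normalized state after `k` interactions and measurements with outcomes `ω`. (On the null set
of outcomes of probability zero the value is `0`.) -/
noncomputable def trajectory (U : Matrix (d × e) (d × e) ℂ) (β : Matrix e e ℂ) (P : ι → Matrix e e ℂ)
    (ρ : Matrix d d ℂ) (ω : ℕ → ι) (k : ℕ) : Matrix d d ℂ :=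
  partialTrace ((unnormalizedState U β P ρ fun j : Fin k => ω j).trace⁻¹ •
    unnormalizedState U β P ρ fun j : Fin k => ω j)

set_option linter.unusedSectionVars false

/-- Singling out the `j`-th copy. -/
def splitAt (d e : Type*) {k : ℕ} (j : Fin k) :
    d × (Fin k → e) ≃ (d × e) × ({i // i ≠ j} → e) :=
  (Equiv.prodCongr (Equiv.refl d) (Equiv.funSplitAt j e)).trans (Equiv.prodAssoc _ _ _).symm

/-- Singling out the last copy. -/
def splitLast (d e : Type*) (k : ℕ) : d × (Fin (k + 1) → e) ≃ (d × (Fin k → e)) × e where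
  toFun x := ((x.1, fun j => x.2 j.castSucc), x.2 (Fin.last k))
  invFun y := (y.1.1, Fin.snoc y.1.2 y.2)
  left_inv x := by
    ext
    · rfl
    · simp only
      rw [show (fun j : Fin k => x.2 j.castSucc) = Fin.init x.2 from rfl, Fin.snoc_init_self]
  right_inv y := by simp

theorem ampliation_eq {k : ℕ} (j : Fin k) (M : Matrix (d × e) (d × e) ℂ) :
    ampliation j M =
      (M ⊗ₖ (1 : Matrix ({i // i ≠ j} → e) _ ℂ)).submatrix (splitAt d e j) (splitAt d e j) := by
  ext x y
  simp [ampliation, splitAt, Matrix.kroneckerMap_apply, Matrix.one_apply, funext_iff]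

theorem ampliation_mul {k : ℕ} (j : Fin k) (M M' : Matrix (d × e) (d × e) ℂ) :
    ampliation j (M * M') = ampliation j M * ampliation j M' := by
  simp only [ampliation_eq, Matrix.submatrix_mul_equiv]
  rw [← Matrix.mul_kronecker_mul, one_mul]

theorem ampliation_one {k : ℕ} (j : Fin k) : ampliation j (1 : Matrix (d × e) (d × e) ℂ) = 1 := by
  rw [ampliation_eq, Matrix.one_kronecker_one, Matrix.submatrix_one_equiv]

theorem ampliation_conjTranspose {k : ℕ} (j : Fin k) (M : Matrix (d × e) (d × e) ℂ) :
    ampliation j Mᴴ = (ampliation j M)ᴴ := by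
  rw [ampliation_eq, ampliation_eq, Matrix.conjTranspose_submatrix, Matrix.conjTranspose_kronecker,
    Matrix.conjTranspose_one]

theorem ampliation_sum {κ : Type*} (s : Finset κ) {k : ℕ} (j : Fin k)
    (M : κ → Matrix (d × e) (d × e) ℂ) :
    ampliation j (∑ a ∈ s, M a) = ∑ a ∈ s, ampliation j (M a) := by
  ext x y
  simp only [ampliation, Matrix.sum_apply, Matrix.of_apply]
  split_ifs <;> simp

/-- Adding one more copy of `H`, on which the operator acts as the identity. -/
def extend {k : ℕ} (W : Matrix (d × (Fin k → e)) (d × (Fin k → e)) ℂ) :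
    Matrix (d × (Fin (k + 1) → e)) (d × (Fin (k + 1) → e)) ℂ :=
  (W ⊗ₖ (1 : Matrix e e ℂ)).submatrix (splitLast d e k) (splitLast d e k)

theorem extend_mul {k : ℕ} (W W' : Matrix (d × (Fin k → e)) (d × (Fin k → e)) ℂ) :
    extend (W * W') = extend W * extend W' := by
  simp only [extend, Matrix.submatrix_mul_equiv]
  rw [← Matrix.mul_kronecker_mul, one_mul]

theorem extend_one {k : ℕ} : extend (1 : Matrix (d × (Fin k → e)) (d × (Fin k → e)) ℂ) = 1 := by
  rw [extend, Matrix.one_kronecker_one, Matrix.submatrix_one_equiv]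

theorem extend_conjTranspose {k : ℕ} (W : Matrix (d × (Fin k → e)) (d × (Fin k → e)) ℂ) :
    extend Wᴴ = (extend W)ᴴ := by
  rw [extend, extend, Matrix.conjTranspose_submatrix, Matrix.conjTranspose_kronecker,
    Matrix.conjTranspose_one]

theorem extend_listProd {k : ℕ} (l : List (Matrix (d × (Fin k → e)) (d × (Fin k → e)) ℂ)) :
    extend l.prod = (l.map extend).prod := by
  induction l with
  | nil => simp [extend_one]
  | cons a l ih => simp [extend_mul, ih]

theorem ampliation_castSucc {k : ℕ} (j : Fin k) (M : Matrix (d × e) (d × e) ℂ) :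
    ampliation j.castSucc M = extend (ampliation j M) := by
  ext x y
  simp only [ampliation, extend, splitLast, Matrix.of_apply, Matrix.submatrix_apply,
    Matrix.kroneckerMap_apply, Matrix.one_apply, Equiv.coe_fn_mk, mul_ite, mul_one, mul_zero,
    Fin.forall_fin_succ', ne_eq, Fin.castSucc_inj]
  have : ¬ (Fin.last k = j.castSucc) := (Fin.castSucc_ne_last j).symm
  simp only [this, not_false_eq_true, forall_const]
  split_ifs <;> simp_all

theorem ampliatedProjector_comm {k : ℕ} {i j : Fin k} (hij : i ≠ j) (P : Matrix e e ℂ)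
    (M : Matrix (d × e) (d × e) ℂ) :
    ampliatedProjector i P * ampliation j M = ampliation j M * ampliatedProjector i P := by
  ext x y
  rw [Matrix.mul_apply, Matrix.mul_apply,
    Finset.sum_eq_single (x.1, Function.update x.2 i (y.2 i)),
    Finset.sum_eq_single (y.1, Function.update y.2 i (x.2 i))]
  · simp only [ampliatedProjector, ampliation, Matrix.of_apply, Matrix.kroneckerMap_apply,
      Matrix.one_apply, Function.update_self, Function.update_of_ne hij.symm, if_true, one_mul]
    have h1 : (∀ l, l ≠ i → x.2 l = Function.update x.2 i (y.2 i) l) := fun l hl => by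
      rw [Function.update_of_ne hl]
    have h2 : (∀ l, l ≠ i → Function.update y.2 i (x.2 i) l = y.2 l) := fun l hl => by
      rw [Function.update_of_ne hl]
    have h3 : (∀ l, l ≠ j → Function.update x.2 i (y.2 i) l = y.2 l) ↔
        (∀ l, l ≠ j → x.2 l = Function.update y.2 i (x.2 i) l) := by
      refine forall_congr' fun l => imp_congr_right fun _ => ?_
      by_cases hl : l = i
      · subst hl; simp
      · rw [Function.update_of_ne hl, Function.update_of_ne hl]
    rw [if_pos h1, if_pos h2]
    simp only [h3]
    split_ifs <;> ring
  · intro z _ hz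
    simp only [ampliatedProjector, ampliation, Matrix.of_apply, Matrix.kroneckerMap_apply,
      Matrix.one_apply]
    by_cases h : (∀ l, l ≠ i → z.2 l = y.2 l) ∧ z.1 = y.1 ∧ (∀ l, l ≠ j → x.2 l = z.2 l)
    · refine (hz (Prod.ext h.2.1 (funext fun l => ?_))).elim
      by_cases hl : l = i
      · subst hl; simpa using (h.2.2 l hij).symm
      · simpa [Function.update_of_ne hl] using h.1 l hl
    · split_ifs <;> simp_all
  · simp
  · intro z _ hz
    simp only [ampliatedProjector, ampliation, Matrix.of_apply, Matrix.kroneckerMap_apply,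
      Matrix.one_apply]
    by_cases h : (∀ l, l ≠ i → x.2 l = z.2 l) ∧ x.1 = z.1 ∧ (∀ l, l ≠ j → z.2 l = y.2 l)
    · refine (hz (Prod.ext h.2.1.symm (funext fun l => ?_))).elim
      by_cases hl : l = i
      · subst hl; simpa using h.2.2 l hij
      · simpa [Function.update_of_ne hl] using (h.1 l hl).symm
    · split_ifs <;> simp_all
  · simp

theorem evolution_succ (U : Matrix (d × e) (d × e) ℂ) (k : ℕ) :
    evolution U (k + 1) = ampliation (Fin.last k) U * extend (evolution U k) := by
  simp only [evolution, List.ofFn_succ', List.concat_eq_append, List.reverse_append,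
    List.reverse_cons, List.reverse_nil, List.nil_append, List.singleton_append, List.prod_cons,
    extend_listProd, List.map_reverse, List.map_ofFn, ampliation_castSucc]
  rfl

theorem initialState_succ (β : Matrix e e ℂ) (ρ : Matrix d d ℂ) (k : ℕ) :
    initialState β ρ (k + 1) =
      (initialState β ρ k ⊗ₖ β).submatrix (splitLast d e k) (splitLast d e k) := by
  ext x y
  simp [initialState, splitLast, Matrix.kroneckerMap_apply, Fin.prod_univ_castSucc, mul_assoc]

theorem initialState_posSemidef {β : Matrix e e ℂ} {ρ : Matrix d d ℂ} (hβ : β.PosSemidef)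
    (hρ : ρ.PosSemidef) (k : ℕ) : (initialState β ρ k).PosSemidef := by
  induction k with
  | zero =>
    have : initialState β ρ 0 = ρ.submatrix Prod.fst Prod.fst := by
      ext x y; simp [initialState]
    rw [this]; exact hρ.submatrix _
  | succ k ih => rw [initialState_succ]; exact (ih.kronecker hβ).submatrix _

/-- The product `P^k_{i_k} ⋯ P^1_{i_1}`. -/
def projectorProd (d : Type*) [Fintype d] [DecidableEq d] (P : ι → Matrix e e ℂ) {k : ℕ}
    (i : Fin k → ι) : Matrix (d × (Fin k → e)) (d × (Fin k → e)) ℂ :=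
  (List.ofFn fun j => ampliatedProjector j (P (i j))).reverse.prod

theorem ampliatedProjector_conjTranspose {k : ℕ} (j : Fin k) {P : Matrix e e ℂ}
    (hP : P.IsHermitian) :
    (ampliatedProjector j P : Matrix (d × (Fin k → e)) _ ℂ)ᴴ = ampliatedProjector j P := by
  rw [ampliatedProjector, ← ampliation_conjTranspose, Matrix.conjTranspose_kronecker,
    Matrix.conjTranspose_one, hP.eq]

theorem projectorProd_conjTranspose {P : ι → Matrix e e ℂ} (hP : ∀ i, (P i).IsHermitian) {k : ℕ}
    (i : Fin k → ι) : (projectorProd d P i)ᴴ =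
      (List.ofFn fun j => ampliatedProjector j (P (i j))).prod := by
  rw [projectorProd, Matrix.conjTranspose_list_prod, List.map_reverse, List.reverse_reverse,
    List.map_ofFn]
  congr 2
  funext j
  exact ampliatedProjector_conjTranspose j (hP _)

theorem projectorProd_succ (P : ι → Matrix e e ℂ) {k : ℕ} (i : Fin (k + 1) → ι) :
    projectorProd d P i = ampliatedProjector (Fin.last k) (P (i (Fin.last k))) *
      extend (projectorProd d P fun j => i j.castSucc) := by
  simp only [projectorProd, ampliatedProjector, List.ofFn_succ', List.concat_eq_append,
    List.reverse_append, List.reverse_cons, List.reverse_nil, List.nil_append,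
    List.singleton_append, List.prod_cons,
    extend_listProd, List.map_reverse, List.map_ofFn, ampliation_castSucc]
  rfl

theorem unnormalizedState_eq (U : Matrix (d × e) (d × e) ℂ) (β : Matrix e e ℂ)
    {P : ι → Matrix e e ℂ} (hP : ∀ i, (P i).IsHermitian) (ρ : Matrix d d ℂ) {k : ℕ}
    (i : Fin k → ι) :
    unnormalizedState U β P ρ i = (projectorProd d P i * evolution U k) * initialState β ρ k *
      (projectorProd d P i * evolution U k)ᴴ := by
  rw [unnormalizedState, ← projectorProd_conjTranspose hP, Matrix.conjTranspose_mul]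
  simp only [projectorProd, mul_assoc]

theorem extend_projectorProd_comm (P : ι → Matrix e e ℂ) {k : ℕ} (i : Fin k → ι)
    (M : Matrix (d × e) (d × e) ℂ) :
    extend (projectorProd d P i) * ampliation (Fin.last k) M =
      ampliation (Fin.last k) M * extend (projectorProd d P i) := by
  rw [projectorProd, extend_listProd]
  refine Commute.list_prod_left _ _ fun b hb => ?_
  simp only [List.map_reverse, List.map_ofFn, List.mem_reverse, List.mem_ofFn] at hb
  obtain ⟨j, rfl⟩ := hb
  simp only [Function.comp, ampliatedProjector, ← ampliation_castSucc]
  exact ampliatedProjector_comm (Fin.castSucc_ne_last j) _ _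

theorem ampliatedProjector_idem {k : ℕ} (j : Fin k) {P : Matrix e e ℂ} (hP : P * P = P) :
    (ampliatedProjector j P : Matrix (d × (Fin k → e)) _ ℂ) * ampliatedProjector j P =
      ampliatedProjector j P := by
  rw [ampliatedProjector, ← ampliation_mul, ← Matrix.mul_kronecker_mul, hP, one_mul]

theorem ampliatedProjector_sum [Fintype ι] {k : ℕ} (j : Fin k) {P : ι → Matrix e e ℂ}
    (hP : ∑ i, P i = 1) :
    ∑ i, (ampliatedProjector j (P i) : Matrix (d × (Fin k → e)) _ ℂ) = 1 := by
  simp only [ampliatedProjector]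
  rw [← ampliation_sum]
  have : ∑ i, (1 : Matrix d d ℂ) ⊗ₖ P i = 1 := by
    rw [← Matrix.one_kronecker_one, ← hP]
    ext x y
    simp [Matrix.sum_apply, Matrix.kroneckerMap_apply, Finset.mul_sum]
  rw [this, ampliation_one]

theorem trace_extend_conj {β : Matrix e e ℂ} (hβ : β.trace = 1) (ρ : Matrix d d ℂ) {k : ℕ}
    (W : Matrix (d × (Fin k → e)) (d × (Fin k → e)) ℂ) :
    (extend W * initialState β ρ (k + 1) * (extend W)ᴴ).trace =
      (W * initialState β ρ k * Wᴴ).trace := by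
  rw [← extend_conjTranspose, initialState_succ]
  simp only [extend, Matrix.submatrix_mul_equiv]
  rw [← Matrix.mul_kronecker_mul, ← Matrix.mul_kronecker_mul, one_mul, mul_one]
  have h : ∀ M : Matrix ((d × (Fin k → e)) × e) ((d × (Fin k → e)) × e) ℂ,
      (M.submatrix (splitLast d e k) (splitLast d e k)).trace = M.trace := fun M => by
    simp only [Matrix.trace, Matrix.diag, Matrix.submatrix_apply]
    exact Equiv.sum_comp (splitLast d e k) fun z => M z z
  rw [h, Matrix.trace_kronecker, hβ, mul_one]

theorem trace_unnormalizedState_succ [Fintype ι] {U : Matrix (d × e) (d × e) ℂ}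
    (hU : U ∈ Matrix.unitaryGroup (d × e) ℂ) {β : Matrix e e ℂ} (hβ : β.trace = 1)
    {P : ι → Matrix e e ℂ} (hP : ∀ i, (P i).IsHermitian) (hP2 : ∀ i, P i * P i = P i)
    (hP1 : ∑ i, P i = 1) (ρ : Matrix d d ℂ) {k : ℕ} (i : Fin k → ι) :
    ∑ a, (unnormalizedState U β P ρ (Fin.snoc i a : Fin (k + 1) → ι)).trace =
      (unnormalizedState U β P ρ i).trace := by
  set W := projectorProd d P i * evolution U k with hW
  set X := ampliation (Fin.last k) U * (extend W * initialState β ρ (k + 1) * (extend W)ᴴ) *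
    (ampliation (Fin.last k) U)ᴴ with hX
  have h1 : ∀ a, (unnormalizedState U β P ρ (Fin.snoc i a : Fin (k + 1) → ι)).trace =
      (ampliatedProjector (Fin.last k) (P a) * X).trace := by
    intro a
    have hA : projectorProd d P (Fin.snoc i a : Fin (k + 1) → ι) * evolution U (k + 1) =
        ampliatedProjector (Fin.last k) (P a) * (ampliation (Fin.last k) U * extend W) := by
      rw [projectorProd_succ, evolution_succ, Fin.snoc_last]
      simp only [Fin.snoc_castSucc]
      rw [hW, extend_mul, mul_assoc, ← mul_assoc (extend _), extend_projectorProd_comm]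
      simp only [mul_assoc]
    rw [unnormalizedState_eq U β hP, hA, Matrix.conjTranspose_mul, Matrix.conjTranspose_mul,
      ampliatedProjector_conjTranspose _ (hP a), ← mul_assoc _ _ (ampliatedProjector _ _),
      Matrix.trace_mul_comm]
    simp only [← mul_assoc]
    rw [ampliatedProjector_idem _ (hP2 a), hX]
    simp only [mul_assoc]
  have hUU : (ampliation (Fin.last k) U)ᴴ * ampliation (Fin.last k) U = 1 := by
    rw [← ampliation_conjTranspose, ← ampliation_mul]
    have := Matrix.mem_unitaryGroup_iff'.1 hU
    rw [Matrix.star_eq_conjTranspose] at this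
    rw [this, ampliation_one]
  rw [Finset.sum_congr rfl fun a _ => h1 a, ← Matrix.trace_sum, ← Finset.sum_mul,
    ampliatedProjector_sum _ hP1, one_mul, hX, Matrix.trace_mul_comm, ← mul_assoc, hUU, one_mul,
    trace_extend_conj hβ, unnormalizedState_eq U β hP]

theorem trace_unnormalizedState_nonneg {U : Matrix (d × e) (d × e) ℂ} {β : Matrix e e ℂ}
    (hβ : β.PosSemidef) {P : ι → Matrix e e ℂ} (hP : ∀ i, (P i).IsHermitian) {ρ : Matrix d d ℂ}
    (hρ : ρ.PosSemidef) {k : ℕ} (i : Fin k → ι) : 0 ≤ (unnormalizedState U β P ρ i).trace := by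
  rw [unnormalizedState_eq U β hP]
  exact ((initialState_posSemidef hβ hρ k).mul_mul_conjTranspose_same _).trace_nonneg

open ProbabilityTheory in
theorem exists_measure_of_consistent {ι : Type*} [Fintype ι] [Nonempty ι] [MeasurableSpace ι]
    [MeasurableSingletonClass ι] (q : ∀ k, (Fin k → ι) → ℝ≥0∞) (h0 : ∀ i, q 0 i = 1)
    (hs : ∀ k i, ∑ a, q (k + 1) (Fin.snoc i a) = q k i) :
    ∃ Q : Measure (ℕ → ι), ∀ k i, Q {ω | ∀ j : Fin k, ω j = i j} = q k i := by
  classical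
  have hfin : ∀ k i, q k i ≤ 1 := by
    intro k
    induction k with
    | zero => intro i; rw [h0]
    | succ k ih =>
      intro i
      refine le_trans ?_ (ih (Fin.init i))
      rw [← hs k (Fin.init i)]
      conv_lhs => rw [← Fin.snoc_init_self i]
      exact Finset.single_le_sum (f := fun a => q (k + 1) (Fin.snoc (Fin.init i) a))
        (fun _ _ => zero_le) (Finset.mem_univ _)
  let pre : ∀ n, ((j : Finset.Iic n) → ι) → (Fin (n + 1) → ι) :=
    fun n h j => h ⟨j, Finset.mem_Iic.2 (Nat.lt_succ_iff.1 j.2)⟩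
  let w : ∀ n, (Fin n → ι) → Measure ι := fun n i =>
    if q n i = 0 then Measure.dirac (Classical.arbitrary ι)
    else ∑ a, (q (n + 1) (Fin.snoc i a) / q n i) • Measure.dirac a
  have hw : ∀ n i, IsProbabilityMeasure (w n i) := by
    intro n i
    by_cases h : q n i = 0
    · simp only [w, h, if_true]; infer_instance
    · constructor
      simp only [w, h, if_false, Measure.coe_finsetSum, Finset.sum_apply, Measure.smul_apply,
        measure_univ, smul_eq_mul, mul_one, div_eq_mul_inv]
      rw [← Finset.sum_mul, hs]
      exact ENNReal.mul_inv_cancel h ((hfin n i).trans_lt ENNReal.one_lt_top).ne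
  have hwa : ∀ n i a, q n i * w n i {a} = q (n + 1) (Fin.snoc i a) := by
    intro n i a
    by_cases h : q n i = 0
    · rw [h, zero_mul]
      have := hs n i
      rw [h, Finset.sum_eq_zero_iff] at this
      exact (this a (Finset.mem_univ _)).symm
    · simp only [w, h, if_false, Measure.coe_finsetSum, Finset.sum_apply, Measure.smul_apply,
        smul_eq_mul, Measure.dirac_apply]
      rw [Finset.sum_eq_single a]
      · simp [ENNReal.mul_div_cancel h ((hfin n i).trans_lt ENNReal.one_lt_top).ne]
      · intro b _ hb; simp [hb]
      · simp
  let κ : (n : ℕ) → Kernel ((j : Finset.Iic n) → ι) ι := fun n =>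
    Kernel.ofFunOfCountable fun h => w (n + 1) (pre n h)
  have hκ : ∀ n, IsMarkovKernel (κ n) := fun n => ⟨fun h => hw _ _⟩
  let μ₀ : Measure ι := w 0 Fin.elim0
  have : IsProbabilityMeasure μ₀ := hw _ _
  refine ⟨Kernel.trajMeasure (X := fun _ => ι) μ₀ κ, ?_⟩
  intro k
  induction k with
  | zero => intro i; simp [h0]
  | succ k ih =>
    intro i
    have hi : i = Fin.snoc (Fin.init i) (i (Fin.last k)) := (Fin.snoc_init_self i).symm
    rcases k with _ | m
    · have hm : (Kernel.trajMeasure (X := fun _ => ι) μ₀ κ).map (Preorder.frestrictLe 0) =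
          μ₀.map (MeasurableEquiv.piUnique (fun _ : Finset.Iic 0 => ι)).symm := by
        rw [Kernel.trajMeasure, Measure.map_comp _ _ (by fun_prop), Kernel.traj_map_frestrictLe,
          Kernel.partialTraj_self, Measure.id_comp]
      have hset : {ω : ℕ → ι | ∀ j : Fin (0 + 1), ω j = i j} =
          Preorder.frestrictLe (π := fun _ => ι) 0 ⁻¹' {h | h ⟨0, by simp⟩ = i 0} := by
        ext ω; simp [Fin.forall_fin_one]
      rw [hset, ← Measure.map_apply (by fun_prop) (Set.toFinite _).measurableSet, hm,
        Measure.map_apply (by fun_prop) (Set.toFinite _).measurableSet]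
      have hset2 : (MeasurableEquiv.piUnique (fun _ : Finset.Iic 0 => ι)).symm ⁻¹'
          {h | h ⟨0, by simp⟩ = i 0} = {i 0} := by
        ext a; rfl
      rw [hset2]
      have := hwa 0 Fin.elim0 (i 0)
      rw [h0, one_mul] at this
      rw [this, hi]
      congr 1
    · have hstep := Kernel.map_frestrictLe_trajMeasure_compProd_eq_map_trajMeasure
        (X := fun _ => ι) (μ₀ := μ₀) (κ := κ) (a := m)
      let hh : (j : Finset.Iic m) → ι := fun j => i ⟨j, by have := Finset.mem_Iic.1 j.2; omega⟩
      have hpre : pre m hh = Fin.init i := by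
        ext j; rfl
      have hset2 : Preorder.frestrictLe (π := fun _ => ι) m ⁻¹' {hh} =
          {ω : ℕ → ι | ∀ j : Fin (m + 1), ω j = Fin.init i j} := by
        ext ω
        simp only [Set.mem_preimage, Set.mem_singleton_iff, Set.mem_ofPred_eq]
        refine ⟨fun h j => ?_, fun h => ?_⟩
        · exact congrFun h ⟨j, Finset.mem_Iic.2 (Nat.lt_succ_iff.1 j.2)⟩
        · ext j
          exact h ⟨j, Nat.lt_succ_iff.2 (Finset.mem_Iic.1 j.2)⟩
      have hset : {ω : ℕ → ι | ∀ j : Fin (m + 1 + 1), ω j = i j} =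
          (fun x : ℕ → ι => (Preorder.frestrictLe (π := fun _ => ι) m x, x (m + 1))) ⁻¹'
            ({hh} ×ˢ {i (Fin.last _)}) := by
        rw [Set.mk_preimage_prod, hset2]
        ext ω
        simp only [Set.mem_ofPred_eq, Fin.forall_fin_succ' (n := m + 1), Set.mem_inter_iff,
          Set.mem_preimage, Set.mem_singleton_iff, Fin.val_castSucc, Fin.val_last]
        rfl
      rw [hset, ← Measure.map_apply (by fun_prop) (Set.toFinite _).measurableSet, ← hstep,
        Measure.compProd_apply_prod (Set.toFinite _).measurableSet
          (Set.toFinite _).measurableSet, lintegral_singleton,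
        Measure.map_apply (by fun_prop) (Set.toFinite _).measurableSet, hset2, ih]
      change w (m + 1) (pre m hh) _ * _ = _
      rw [hpre, mul_comm, hwa, ← hi]

theorem exists_outcomeLaw [Fintype ι] [MeasurableSpace ι] [MeasurableSingletonClass ι]
    {U : Matrix (d × e) (d × e) ℂ} (hU : U ∈ Matrix.unitaryGroup (d × e) ℂ)
    {β : Matrix e e ℂ} (hβ : IsState β) {A : Matrix e e ℂ} {lam : ι → ℝ} {P : ι → Matrix e e ℂ}
    (hP : IsSpectralDecomposition A lam P) {ρ : Matrix d d ℂ} (hρ : IsState ρ) :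
    ∃ Q : Measure (ℕ → ι), IsOutcomeLaw U β P ρ Q := by
  have : Nonempty ι := by
    by_contra h
    rw [not_nonempty_iff] at h
    have h1 := hP.sum_eq_one
    rw [Finset.univ_eq_empty, Finset.sum_empty] at h1
    have h2 := hβ.2
    rw [← mul_one β, ← h1, mul_zero, Matrix.trace_zero] at h2
    exact zero_ne_one h2
  refine exists_measure_of_consistent
    (fun k i => ENNReal.ofReal (unnormalizedState U β P ρ i).trace.re) ?_ ?_
  · intro i
    have : (unnormalizedState U β P ρ i).trace = 1 := by
      rw [← hρ.2]
      simp [unnormalizedState, evolution, initialState, Matrix.trace, Fintype.sum_prod_type]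
    simp [this]
  · intro k i
    rw [← trace_unnormalizedState_succ hU hβ.2 hP.hermitian hP.idempotent hP.sum_eq_one ρ i,
      Complex.re_sum, ENNReal.ofReal_sum_of_nonneg]
    intro a _
    exact (Complex.le_def.1 (trace_unnormalizedState_nonneg hβ.1 hP.hermitian hρ.1 _)).1

/-- The law of the sequence of outcomes of the repeated measurements started from the state `ρ`:
the probability measure on `ℕ → ι` determined by its values on cylinders, see `IsOutcomeLaw`. -/
noncomputable def outcomeLaw [Fintype ι] [MeasurableSpace ι] [MeasurableSingletonClass ι]
    {U : Matrix (d × e) (d × e) ℂ} (hU : U ∈ Matrix.unitaryGroup (d × e) ℂ)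
    {β : Matrix e e ℂ} (hβ : IsState β) {A : Matrix e e ℂ} {lam : ι → ℝ} {P : ι → Matrix e e ℂ}
    (hP : IsSpectralDecomposition A lam P) {ρ : Matrix d d ℂ} (hρ : IsState ρ) :
    Measure (ℕ → ι) :=
  (exists_outcomeLaw hU hβ hP hρ).choose

theorem isOutcomeLaw_outcomeLaw [Fintype ι] [MeasurableSpace ι] [MeasurableSingletonClass ι]
    {U : Matrix (d × e) (d × e) ℂ} (hU : U ∈ Matrix.unitaryGroup (d × e) ℂ)
    {β : Matrix e e ℂ} (hβ : IsState β) {A : Matrix e e ℂ} {lam : ι → ℝ} {P : ι → Matrix e e ℂ}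
    (hP : IsSpectralDecomposition A lam P) {ρ : Matrix d d ℂ} (hρ : IsState ρ) :
    IsOutcomeLaw U β P ρ (outcomeLaw hU hβ hP hρ) :=
  (exists_outcomeLaw hU hβ hP hρ).choose_spec

/-- The vacuum state `|X₀⟩⟨X₀|`. -/
def vacuum (x₀ : e) : Matrix e e ℂ := Matrix.single x₀ x₀ 1

theorem isState_vacuum (x₀ : e) : IsState (vacuum x₀) := by
  constructor
  · rw [vacuum, ← Matrix.diagonal_single, Matrix.posSemidef_diagonal_iff]
    intro i
    by_cases h : i = x₀
    · subst h; simp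
    · simp [h]
  · simp [vacuum]

/-- The block `U_{ij}`, an operator on `H₀`, of an operator `U` on `H₀ ⊗ H`. -/
def block (U : Matrix (d × e) (d × e) ℂ) (i j : e) : Matrix d d ℂ :=
  Matrix.of fun a b => U (a, i) (b, j)

/-- The process `t ↦ ρ_n(t) = ρ_[n t]` built from the trajectory with interaction `U`. -/
noncomputable def trajectoryPath (n : ℕ) (U : Matrix (d × e) (d × e) ℂ) (β : Matrix e e ℂ)
    (P : ι → Matrix e e ℂ) (ρ : Matrix d d ℂ) (ω : ℕ → ι) : CadlagPath (Matrix d d ℂ) :=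
  stepPath n (trajectory U β P ρ ω)

end Quantum

end QTraj

open QTraj

/-! Everything rests on a one-step inequality: given the first `k` outcomes, and for every `Y` in
the unit ball that is known at time `k`, the conditional mean of `‖ρ_{k+1} - Y‖²` is at most `‖ρ_k -
Y‖² + C/n`. This is `HasSmallIncrements`, proved in `exists_hasSmallIncrements_trajectory`. To see
it, expand the square around `ρ_k`. The cross term contains the conditional mean of `ρ_{k+1} - ρ_k`,
which is `∑ V_j ρ_k V_jᴴ - ρ_k` with `V_j = U_{j0}(n)`; it is `O(1/n)`, because `V_0 = I + O(1/n)`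
and the other `V_j` are `O(1/√n)`. The quadratic term is bounded outcome by outcome, according to `q
= ‖P X₀‖²`. If `q > 0`, the outcome multiplies the state by `q` up to `O(1/√n)`, so the normalized
state moves by `O(1/√n)`. If `q = 0`, the jump may be large, but its probability is `O(1/n)`. The
constant depends neither on the state nor on `n`.

For the moment bound, iterate the inequality from `k` to `l` with weight `‖ρ_k - ρ_j‖²` and then
from `j` to `k`: the expectation is at most `(C/n)² (l - k)(k - j)`. It remains to compare integer
parts with times. If `l = k` or `k = j` there is nothing to prove; otherwise `l - j ≥ 2`, and the
rounding error is absorbed.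

Tightness also comes from the one-step inequality. Cut a path greedily, with a reset each time it
has moved by more than `ε` from the last reference point. The squared distance to the reference
point gains at most `C/n` per step in mean and loses at least `ε²` at each reset, which bounds the
expected number of resets. Counting only the steps at which the last reset is less than `h` steps
old bounds the expected number of resets that follow too closely, by a quantity of order `h/n` on a
bounded time interval (`HasSmallIncrements.measureReal_short_le`). So, uniformly in `n`, with high
probability the path has well separated break points between which it oscillates little. Paths in a
compact set with such break sets, for a sequence of oscillations tending to zero and horizons
tending to infinity, form a compact set in the Skorokhod topology (`isCompact_sparseBreakPaths`). -/

namespace QTraj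

/-! ### Sparse sets of break points and their limits along filters -/

section BreakSets

/-- The points of `S` are at distance at least `δ` from each other and from the origin. -/
def IsSparse (S : Set ℝ≥0) (δ : ℝ) : Prop :=
  (∀ s ∈ S, δ ≤ s) ∧ ∀ s ∈ S, ∀ s' ∈ S, s < s' → (s : ℝ) + δ ≤ s'

/-- `S` is a `δ`-sparse set of break points, between which the path `x` oscillates by at most `ε`
before time `T`. -/
structure IsBreakSet {E : Type*} [PseudoMetricSpace E] (S : Set ℝ≥0) (x : ℝ≥0 → E) (T δ ε : ℝ) :
    Prop where
  sparse : IsSparse S δ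
  dist_le : ∀ t t' : ℝ≥0, (t : ℝ) < T → (t' : ℝ) < T → (∀ s ∈ S, s ≤ t ↔ s ≤ t') →
    dist (x t) (x t') ≤ ε

theorem IsSparse.mono {S : Set ℝ≥0} {δ δ' : ℝ} (h : IsSparse S δ) (hδ : δ' ≤ δ) :
    IsSparse S δ' :=
  ⟨fun s hs => hδ.trans (h.1 s hs), fun s hs s' hs' hlt => by linarith [h.2 s hs s' hs' hlt]⟩

theorem IsSparse.exists_right_gap {S : Set ℝ≥0} {δ : ℝ} (h : IsSparse S δ) (hδ : 0 < δ) (t : ℝ≥0) :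
    ∃ u, t < u ∧ ∀ s ∈ S, t < s → u ≤ s := by
  by_cases hex : ∃ s ∈ S, t < s ∧ (s : ℝ) < t + δ
  · obtain ⟨s, hs, hts, hsd⟩ := hex
    refine ⟨s, hts, fun s' hs' hts' => ?_⟩
    by_contra hlt
    push Not at hlt
    have := h.2 s' hs' s hs hlt
    have h3 : (t : ℝ) < s' := hts'
    linarith
  · push Not at hex
    refine ⟨t + ⟨δ, hδ.le⟩, lt_add_of_pos_right _ hδ, fun s hs hts => ?_⟩
    exact_mod_cast hex s hs hts

theorem IsSparse.exists_left_gap {S : Set ℝ≥0} {δ : ℝ} (h : IsSparse S δ) (hδ : 0 < δ) {t : ℝ≥0}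
    (ht : 0 < t) : ∃ u, u < t ∧ ∀ s ∈ S, s < t → s ≤ u := by
  by_cases hex : ∃ s ∈ S, s < t ∧ (t : ℝ) < s + δ
  · obtain ⟨s, hs, hts, hsd⟩ := hex
    refine ⟨s, hts, fun s' hs' hts' => ?_⟩
    by_contra hlt
    push Not at hlt
    have := h.2 s hs s' hs' hlt
    have h3 : (s' : ℝ) < t := hts'
    linarith
  · push Not at hex
    refine ⟨t - ⟨δ, hδ.le⟩, tsub_lt_self ht hδ, fun s hs hts => ?_⟩
    exact le_tsub_of_add_le_right (by exact_mod_cast hex s hs hts)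

/-- Two distinct points at distance at least `δ` have different integer parts after division by `δ`.
-/
theorem IsSparse.finite_inter_Iic {S : Set ℝ≥0} {δ : ℝ} (h : IsSparse S δ) (hδ : 0 < δ) (T : ℝ≥0) :
    (S ∩ Set.Iic T).Finite := by
  refine Set.Finite.of_injOn (f := fun s : ℝ≥0 => ⌊(s : ℝ) / δ⌋₊)
    (t := Set.Iic ⌊(T : ℝ) / δ⌋₊) ?_ ?_ (Set.finite_Iic _)
  · intro s hs
    refine Nat.floor_mono ?_
    have : (s : ℝ) ≤ T := hs.2
    gcongr
  · have key : ∀ s ∈ S, ∀ s' ∈ S, s < s' → ⌊(s : ℝ) / δ⌋₊ < ⌊(s' : ℝ) / δ⌋₊ := by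
      intro s hs s' hs' hlt
      rw [Nat.lt_iff_add_one_le]
      refine Nat.le_floor ?_
      push_cast
      have h1 := Nat.floor_le (a := (s : ℝ) / δ) (by positivity)
      have h2 : (s : ℝ) / δ + 1 ≤ s' / δ := by
        rw [div_add_one hδ.ne']
        have := h.2 s hs s' hs' hlt
        gcongr
      linarith
    intro s hs s' hs' heq
    rcases lt_trichotomy s s' with hlt | rfl | hlt
    · exact absurd heq (key s hs.1 s' hs'.1 hlt).ne
    · rfl
    · exact absurd heq (key s' hs'.1 s hs.1 hlt).ne'

variable {X : Type*}

/-- The limit of a family of sets along a filter: the points all of whose neighbourhoods eventually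
meet the sets of the family. -/
def limitSet (F : Filter X) (S : X → Set ℝ≥0) : Set ℝ≥0 :=
  {s | ∀ r : ℝ, 0 < r → ∀ᶠ x in F, ∃ s' ∈ S x, dist s' s < r}

/-- The separation inequalities are not strict, so they pass to the limit. -/
theorem isSparse_limitSet {F : Filter X} [F.NeBot] {S : X → Set ℝ≥0} {δ : ℝ}
    (h : ∀ᶠ x in F, IsSparse (S x) δ) : IsSparse (limitSet F S) δ := by
  constructor
  · intro s hs
    refine le_of_forall_pos_le_add fun r hr => ?_
    obtain ⟨x, hx, s', hs', hd⟩ := (h.and (hs r hr)).exists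
    have h1 := hx.1 s' hs'
    rw [NNReal.dist_eq, abs_lt] at hd
    linarith [hd.2]
  · intro s hs t ht hst
    refine le_of_forall_pos_le_add fun r hr => ?_
    have hst' : (s : ℝ) < t := hst
    -- The bound `(t - s) / 2` keeps the approximating points in the same order as `s` and `t`; `r /
    -- 2` makes their two errors add up to `r`.
    have hr' : 0 < min (r / 2) ((t - s) / 2) := lt_min (by linarith) (by linarith)
    obtain ⟨x, hx, ⟨s', hs', hd⟩, t', ht', hd'⟩ := (h.and ((hs _ hr').and (ht _ hr'))).exists
    rw [NNReal.dist_eq, lt_min_iff, abs_lt, abs_lt] at hd hd'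
    have hlt : s' < t' := by
      rw [← NNReal.coe_lt_coe]
      linarith [hd.2.2, hd'.2.1]
    have := hx.2 s' hs' t' ht' hlt
    linarith [hd.1.1, hd'.1.2]

/-- Along an ultrafilter, a ball that is not eventually met is eventually avoided; finitely many
such balls cover `C`. -/
theorem eventually_disjoint_of_limitSet (F : Ultrafilter X) (S : X → Set ℝ≥0) {C : Set ℝ≥0}
    (hC : IsCompact C) (h : ∀ s ∈ C, s ∉ limitSet (F : Filter X) S) :
    ∀ᶠ x in (F : Filter X), ∀ s ∈ S x, s ∉ C := by
  refine hC.induction_on (p := fun D => ∀ᶠ x in (F : Filter X), ∀ s ∈ S x, s ∉ D) ?_ ?_ ?_ ?_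
  · simp
  · intro D D' hDD h
    filter_upwards [h] with x hx s hs hsD
    exact hx s hs (hDD hsD)
  · intro D D' hD hD'
    filter_upwards [hD, hD'] with x h1 h2 s hs hsD
    exact hsD.elim (h1 s hs) (h2 s hs)
  · intro s hs
    have := h s hs
    simp only [limitSet, Set.mem_ofPred_eq, not_forall] at this
    obtain ⟨r, hr, h1⟩ := this
    refine ⟨Metric.ball s r, mem_nhdsWithin_of_mem_nhds (Metric.ball_mem_nhds s hr), ?_⟩
    rw [← Ultrafilter.eventually_not] at h1
    filter_upwards [h1] with x hx s' hs' hd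
    exact hx ⟨s', hs', hd⟩

end BreakSets

/-- A perturbation of the identity by a contraction which vanishes at the origin is a time
change. -/
theorem exists_orderIso_eq_add {g : ℝ≥0 → ℝ} {κ : ℝ≥0} (hg : LipschitzWith κ g) (hκ : κ < 1)
    (hg0 : g 0 = 0) : ∃ τ : ℝ≥0 ≃o ℝ≥0, ∀ t, (τ t : ℝ) = t + g t := by
  have hκ' : (κ : ℝ) < 1 := hκ
  have hL : ∀ s t : ℝ≥0, |g s - g t| ≤ κ * |(s : ℝ) - t| := fun s t => by
    simpa [Real.dist_eq, NNReal.dist_eq] using hg.dist_le_mul s t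
  have hnn : ∀ t : ℝ≥0, (1 - κ : ℝ) * t ≤ t + g t := fun t => by
    have := hL t 0
    rw [hg0, NNReal.coe_zero, sub_zero, sub_zero, abs_of_nonneg t.coe_nonneg, abs_le] at this
    linarith [this.1]
  have hpos : ∀ t : ℝ≥0, 0 ≤ (t : ℝ) + g t := fun t =>
    (mul_nonneg (by linarith) t.coe_nonneg).trans (hnn t)
  let f : ℝ≥0 → ℝ≥0 := fun t => ⟨t + g t, hpos t⟩
  have hmono : StrictMono f := fun s t hst => by
    change (s : ℝ) + g s < t + g t
    have h1 : (s : ℝ) < t := hst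
    have h2 := hL t s
    rw [abs_of_pos (sub_pos.2 h1), abs_le] at h2
    nlinarith [h2.1]
  have hcont : Continuous f := by
    refine Continuous.subtype_mk ?_ _
    exact NNReal.continuous_coe.add hg.continuous
  -- Since `(1 - κ) t ≤ t + g t`, the value at `v / (1 - κ)` is at least `v`, and the intermediate
  -- value theorem applies.
  have hsurj : Function.Surjective f := fun v => by
    have h1 : v ∈ Set.Icc (f 0) (f (v / (1 - κ))) := by
      constructor
      · rw [← NNReal.coe_le_coe]
        change ((0 : ℝ≥0) : ℝ) + g 0 ≤ v
        simp [hg0]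
      · rw [← NNReal.coe_le_coe]
        refine le_trans (le_of_eq ?_) (hnn _)
        rw [NNReal.coe_div, NNReal.coe_sub hκ.le, NNReal.coe_one]
        field_simp [show (1 - κ : ℝ) ≠ 0 by linarith]
    obtain ⟨t, -, ht⟩ := intermediate_value_Icc zero_le hcont.continuousOn h1
    exact ⟨t, ht⟩
  exact ⟨hmono.orderIsoOfSurjective f hsurj, fun t => rfl⟩

/-! ### Compact sets in the Skorokhod space -/

section Compactness

variable {E : Type*} [MetricSpace E]

/-- Right limits at two different times can then be taken along one common parameter `h`. -/
theorem tendsto_add_right_nhdsGT (t : ℝ≥0) :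
    Tendsto (fun h : ℝ≥0 => t + h) (𝓝[>] 0) (𝓝[>] t) := by
  refine tendsto_nhdsWithin_iff.2 ⟨?_, ?_⟩
  · have : Tendsto (fun h : ℝ≥0 => t + h) (𝓝 0) (𝓝 (t + 0)) :=
      (continuous_const.add continuous_id).tendsto 0
    rw [add_zero] at this
    exact this.mono_left nhdsWithin_le_nhds
  · filter_upwards [self_mem_nhdsWithin] with h hh
    exact lt_add_of_pos_right _ (Set.mem_Ioi.1 hh)

/-- A function with sparse break sets for arbitrarily small oscillations, constrained only on
closed intervals that avoid the break points, has right limits. -/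
theorem exists_tendsto_nhdsGT [CompleteSpace E] {y : ℝ≥0 → E} {T ε : ℕ → ℝ}
    {L : ℕ → Set ℝ≥0} (hT : ∀ a η : ℝ, 0 < η → ∃ m, a < T m ∧ ε m < η)
    (hgap : ∀ m t, ∃ u, t < u ∧ ∀ s ∈ L m, t < s → u ≤ s)
    (hy : ∀ m (t t' : ℝ≥0), (t : ℝ) < T m → (t' : ℝ) < T m → t ≤ t' →
      (∀ s ∈ L m, ¬ (t ≤ s ∧ s ≤ t')) → dist (y t) (y t') ≤ ε m) (t : ℝ≥0) :
    ∃ z, Tendsto y (𝓝[>] t) (𝓝 z) := by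
  refine cauchy_map_iff_exists_tendsto.1 (Metric.cauchy_iff.2 ⟨inferInstance, fun η hη => ?_⟩)
  obtain ⟨m, hm, hmε⟩ := hT (t + 1) η hη
  obtain ⟨u, htu, hu⟩ := hgap m t
  have hlt : t < min u (t + 1) := lt_min htu (lt_add_one t)
  refine ⟨y '' Set.Ioo t (min u (t + 1)), image_mem_map (Ioo_mem_nhdsGT hlt), ?_⟩
  have key : ∀ a ∈ Set.Ioo t (min u (t + 1)), ∀ b ∈ Set.Ioo t (min u (t + 1)), a ≤ b →
      dist (y a) (y b) < η := by
    intro a ha b hb hab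
    have hb1 : (b : ℝ) < t + 1 := by exact_mod_cast hb.2.trans_le (min_le_right _ _)
    have hab' : (a : ℝ) ≤ b := hab
    refine (hy m a b (by linarith) (by linarith) hab fun s hs h => ?_).trans_lt hmε
    exact absurd (hu s hs (ha.1.trans_le h.1))
      (not_le.2 (h.2.trans_lt (hb.2.trans_le (min_le_left _ _))))
  rintro _ ⟨a, ha, rfl⟩ _ ⟨b, hb, rfl⟩
  rcases le_total a b with hab | hab
  · exact key a ha b hb hab
  · rw [dist_comm]; exact key b hb a ha hab

/-- A function with sparse break sets for arbitrarily small oscillations is càdlàg. -/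
theorem exists_cadlagPath [CompleteSpace E] {z : ℝ≥0 → E} {T δ ε : ℕ → ℝ} {L : ℕ → Set ℝ≥0}
    (hT : ∀ a η : ℝ, 0 < η → ∃ m, a < T m ∧ ε m < η) (hδ : ∀ m, 0 < δ m)
    (hz : ∀ m, IsBreakSet (L m) z (T m) (δ m) (ε m)) : ∃ x : CadlagPath E, x.toFun = z := by
  refine ⟨⟨z, fun t => ?_, fun t => ?_⟩, rfl⟩
  · rw [Metric.continuousWithinAt_iff']
    intro η hη
    obtain ⟨m, hm, hmε⟩ := hT (t + 1) η hη
    obtain ⟨u, htu, hu⟩ := (hz m).sparse.exists_right_gap (hδ m) t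
    filter_upwards [Ico_mem_nhdsGE (lt_min htu (lt_add_one t))] with s hs
    have hs1 : (s : ℝ) < t + 1 := by exact_mod_cast hs.2.trans_le (min_le_right _ _)
    refine ((hz m).dist_le s t (by linarith) (by linarith) fun r hr => ⟨fun h => ?_, fun h =>
      h.trans hs.1⟩).trans_lt hmε
    by_contra hlt
    exact absurd (hu r hr (not_le.1 hlt))
      (not_le.2 (h.trans_lt (hs.2.trans_le (min_le_left _ _))))
  · rcases eq_zero_or_pos t with rfl | ht
    · refine ⟨z 0, ?_⟩
      have : Set.Iio (0 : ℝ≥0) = ∅ := by ext; simp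
      rw [this]; simp
    have : (𝓝[<] t).NeBot := nhdsLT_neBot_of_exists_lt ⟨0, ht⟩
    refine cauchy_map_iff_exists_tendsto.1 (Metric.cauchy_iff.2 ⟨inferInstance, fun η hη => ?_⟩)
    obtain ⟨m, hm, hmε⟩ := hT t η hη
    obtain ⟨u, hut, hu⟩ := (hz m).sparse.exists_left_gap (hδ m) ht
    refine ⟨z '' Set.Ioo u t, image_mem_map (Ioo_mem_nhdsLT hut), ?_⟩
    rintro _ ⟨a, ha, rfl⟩ _ ⟨b, hb, rfl⟩
    have ha' : (a : ℝ) < t := ha.2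
    have hb' : (b : ℝ) < t := hb.2
    exact ((hz m).dist_le a b (by linarith) (by linarith) fun s hs =>
      ⟨fun h => (hu s hs (h.trans_lt ha.2)).trans hb.1.le,
        fun h => (hu s hs (h.trans_lt hb.2)).trans ha.1.le⟩).trans_lt hmε

/-- Paths which agree up to `ε` at finitely many test points, and whose break points are close to
each other, are close in the Skorokhod topology. -/
theorem exists_timeChange {x z : ℝ≥0 → E} {S L : Set ℝ≥0} {T δ ε η r : ℝ} {κ : ℝ≥0} {T₀ : ℝ≥0}
    (hx : IsBreakSet S x T δ ε) (hz : IsBreakSet L z T δ ε) (hδ : 0 < δ) (hδ1 : δ ≤ 1)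
    (hT : (T₀ : ℝ) + 2 < T) (hκ : (κ : ℝ) ≤ 1 / 2) (hr : r = κ * δ / 2)
    (hκT : 2 * (κ : ℝ) * T₀ < min η 1)
    (hLS : ∀ s ∈ L, s ≤ T₀ + 1 → ∃ s' ∈ S, dist s' s < r)
    (hSL : ∀ s' ∈ S, s' ≤ T₀ → ∃ s ∈ L, dist s' s < r)
    (hq : ∀ s : ℝ≥0, (s = 0 ∨ s ∈ L) → s ≤ T₀ + 1 → ∀ q : ℝ≥0, (q : ℝ) = s + δ / 2 →
      dist (x q) (z q) + 2 * ε < η) :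
    ∃ τ : ℝ≥0 ≃o ℝ≥0, ∀ t ≤ T₀, dist (τ t) t < η ∧ dist (x t) (z (τ t)) < η := by
  have hκ0 : (0 : ℝ) ≤ κ := κ.coe_nonneg
  have hκδ : (κ : ℝ) * δ ≤ 1 / 2 * δ := mul_le_mul_of_nonneg_right hκ hδ.le
  have hr2 : r ≤ δ / 4 := by rw [hr]; linarith
  have hu : ∀ s, ∃ s', s ∈ L → s ≤ T₀ + 1 → s' ∈ S ∧ dist s' s < r := by
    intro s
    by_cases h : s ∈ L ∧ s ≤ T₀ + 1
    · obtain ⟨s', h1, h2⟩ := hLS s h.1 h.2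
      exact ⟨s', fun _ _ => ⟨h1, h2⟩⟩
    · exact ⟨0, fun h1 h2 => (h ⟨h1, h2⟩).elim⟩
  choose u hu using hu
  set D : Set ℝ≥0 := L ∩ Set.Iic (T₀ + 1) with hD
  have h0D : (0 : ℝ≥0) ∉ D := fun h => by
    have := hz.sparse.1 0 h.1
    simp only [NNReal.coe_zero] at this
    linarith
  classical
  -- The displacement that carries each break point of `z` to the nearby break point of `x`, and
  -- fixes the origin.
  let g₀ : ℝ≥0 → ℝ := fun s => if s ∈ D then (u s : ℝ) - s else 0
  have hur : ∀ s ∈ D, u s ∈ S ∧ |(u s : ℝ) - s| < r := fun s hs => by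
    have := hu s hs.1 hs.2
    rwa [NNReal.dist_eq] at this
  have hg₀r : ∀ s ∈ insert 0 D, |g₀ s| ≤ r := by
    intro s hs
    by_cases h : s ∈ D
    · simp only [g₀, h, if_true]
      exact (hur s h).2.le
    · simp only [g₀, h, if_false, abs_zero]
      rw [hr]; positivity
  have hsepD : ∀ s ∈ insert 0 D, ∀ s' ∈ insert 0 D, s < s' → (s : ℝ) + δ ≤ s' := by
    rintro s hs s' (rfl | hs') hlt
    · exact absurd hlt (not_lt.2 zero_le)
    · rcases hs with rfl | hs
      · simpa using hz.sparse.1 s' hs'.1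
      · exact hz.sparse.2 s hs.1 s' hs'.1 hlt
  -- The choice `r = κ δ / 2` is made for this: two displacements differ by at most `2 r = κ δ`,
  -- while their base points are `δ` apart.
  have hlip : LipschitzOnWith κ g₀ (insert 0 D) := by
    refine LipschitzOnWith.of_dist_le_mul fun a ha b hb => ?_
    rcases eq_or_ne a b with rfl | hab
    · simp
    have h1 : δ ≤ dist a b := by
      rw [NNReal.dist_eq]
      rcases lt_or_gt_of_ne hab with hlt | hlt
      · rw [abs_sub_comm]
        exact (by linarith [hsepD a ha b hb hlt] : δ ≤ (b : ℝ) - a).trans (le_abs_self _)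
      · exact (by linarith [hsepD b hb a ha hlt] : δ ≤ (a : ℝ) - b).trans (le_abs_self _)
    have h2 : dist (g₀ a) (g₀ b) ≤ r + r := by
      rw [Real.dist_eq]
      exact (abs_sub _ _).trans (add_le_add (hg₀r a ha) (hg₀r b hb))
    calc dist (g₀ a) (g₀ b) ≤ κ * δ := by rw [hr] at h2; linarith
      _ ≤ κ * dist a b := by gcongr
  obtain ⟨g, hg, hgeq⟩ := hlip.extend_real
  have hg0 : g 0 = 0 := by
    rw [← hgeq (Set.mem_insert _ _)]
    simp [g₀, h0D]
  have hκ1 : κ < 1 := by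
    rw [← NNReal.coe_lt_coe, NNReal.coe_one]
    linarith
  obtain ⟨σ, hσ⟩ := exists_orderIso_eq_add hg hκ1 hg0
  have hσD : ∀ s ∈ D, σ s = u s := fun s hs => by
    rw [← NNReal.coe_inj, hσ, ← hgeq (Set.mem_insert_of_mem _ hs)]
    simp [g₀, hs]
  have hgκ : ∀ s : ℝ≥0, |g s| ≤ κ * s := fun s => by
    simpa [Real.dist_eq, NNReal.dist_eq, hg0] using hg.dist_le_mul s 0
  -- As `σ` sends the break points of `z` to those of `x`, the time change required is its inverse;
  -- write `t = σ w`.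
  refine ⟨σ.symm, fun t ht => ?_⟩
  obtain ⟨w, rfl⟩ := σ.surjective t
  rw [OrderIso.symm_apply_apply]
  have htT : (σ w : ℝ) ≤ T₀ := ht
  have hw2 : (w : ℝ) ≤ 2 * T₀ := by
    have h1 := abs_le.1 (hgκ w)
    have h3 : (κ : ℝ) * w ≤ 1 / 2 * w := by gcongr
    rw [hσ] at htT
    linarith [h1.1]
  have hdist : |(w : ℝ) - σ w| < min η 1 := by
    rw [hσ, abs_sub_comm, add_sub_cancel_left]
    refine (hgκ w).trans_lt (lt_of_le_of_lt ?_ hκT)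
    calc (κ : ℝ) * w ≤ κ * (2 * T₀) := by gcongr
      _ = _ := by ring
  refine ⟨by rw [NNReal.dist_eq]; exact hdist.trans_le (min_le_left _ _), ?_⟩
  have hwT : (w : ℝ) < T₀ + 1 := by
    have := (abs_lt.1 (hdist.trans_le (min_le_right _ _))).2
    linarith
  have hwT' : w ≤ T₀ + 1 := by
    rw [← NNReal.coe_le_coe]; push_cast; exact hwT.le
  have hfin : (insert 0 D ∩ Set.Iic w).Finite :=
    ((hz.sparse.finite_inter_Iic hδ _).insert 0).inter_of_left _
  -- Here `s` is the last break point of `z` up to time `w`, or the origin. The comparison goes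
  -- through the test point `q = s + δ / 2`, which lies safely inside the gap after `s` for `z`, and
  -- inside the corresponding gap for `x`.
  obtain ⟨s, ⟨hsD, hsw⟩, hmax⟩ := hfin.exists_maximalFor id _ ⟨0, Set.mem_insert _ _, Set.mem_Iic.2 zero_le⟩
  have hmax' : ∀ s₁ ∈ L, s₁ ≤ w → s₁ ≤ s := fun s₁ h₁ h₂ => by
    rcases le_total s₁ s with h | h
    · exact h
    · exact hmax ⟨Set.mem_insert_of_mem _ ⟨h₁, h₂.trans hwT'⟩, h₂⟩ h
  have hsw' : (s : ℝ) ≤ w := hsw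
  obtain ⟨q, hqs⟩ : ∃ q : ℝ≥0, (q : ℝ) = s + δ / 2 := ⟨⟨s + δ / 2, by positivity⟩, rfl⟩
  have hsq : s ≤ q := by
    rw [← NNReal.coe_le_coe]; linarith
  have hqT : (q : ℝ) < T := by linarith
  have hs0 : s = 0 ∨ s ∈ L := hsD.imp_right fun h => h.1
  have e1 : dist (z q) (z w) ≤ ε := by
    refine hz.dist_le q w hqT (by linarith) fun s₁ hs₁ => ⟨fun h => ?_, fun h =>
      (hmax' s₁ hs₁ h).trans hsq⟩
    by_contra hlt
    push Not at hlt
    have h1 : (s : ℝ) + δ ≤ s₁ := by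
      rcases hs0 with rfl | hs0
      · simpa using hz.sparse.1 s₁ hs₁
      · exact hz.sparse.2 s hs0 s₁ hs₁ (lt_of_le_of_lt hsw hlt)
    have h2 : (s₁ : ℝ) ≤ q := h
    linarith
  -- A break point `s'` of `x` up to `σ w` is the image `σ s₁` of some break point `s₁ ≤ s` of `z`,
  -- hence precedes `q`. Conversely, a break point of `x` up to `q` cannot exceed `σ s`, since the
  -- next one is at least `δ` later and `r ≤ δ / 4`.
  have e2 : dist (x (σ w)) (x q) ≤ ε := by
    refine hx.dist_le (σ w) q (by linarith) hqT fun s' hs' => ⟨fun h => ?_, fun h => ?_⟩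
    · obtain ⟨s₁, hs₁, hd⟩ := hSL s' hs' (h.trans ht)
      rw [NNReal.dist_eq, abs_lt] at hd
      have h' : (s' : ℝ) ≤ σ w := h
      have hs₁D : s₁ ∈ D := by
        refine ⟨hs₁, ?_⟩
        rw [Set.mem_Iic, ← NNReal.coe_le_coe]; push_cast
        linarith [hd.1]
      have hu₁ := hur s₁ hs₁D
      have hu₁' := abs_lt.1 hu₁.2
      have heq : s' = u s₁ := by
        rcases lt_trichotomy s' (u s₁) with hlt | heq | hlt
        · linarith [hx.sparse.2 _ hs' _ hu₁.1 hlt, hd.1, hu₁'.2]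
        · exact heq
        · linarith [hx.sparse.2 _ hu₁.1 _ hs' hlt, hd.2, hu₁'.1]
      rw [heq, ← hσD s₁ hs₁D] at h
      have h3 : (s₁ : ℝ) ≤ s := hmax' s₁ hs₁ (σ.le_iff_le.1 h)
      rw [← NNReal.coe_le_coe, hqs]
      linarith [hd.2]
    · have h1 : (s' : ℝ) ≤ s + δ / 2 := by rw [← hqs]; exact h
      refine le_trans ?_ (σ.monotone hsw)
      by_contra hlt
      push Not at hlt
      rcases hsD with rfl | hsD
      · have := hx.sparse.1 s' hs'
        rw [NNReal.coe_zero] at h1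
        linarith
      · rw [hσD s hsD] at hlt
        have hu₁ := hur s hsD
        have hu₁' := abs_lt.1 hu₁.2
        linarith [hx.sparse.2 _ hu₁.1 _ hs' hlt, hu₁'.1]
  have e3 := hq s hs0 (hsw.trans hwT') q hqs
  have t1 := dist_triangle4 (x (σ w)) (x q) (z q) (z w)
  linarith

/-- The càdlàg paths with values in a compact set `B` and with prescribed sparseness `δ m` of the
break points for oscillations `ε m` before the time `T m`. -/
def sparseBreakPaths (B : Set E) (T δ ε : ℕ → ℝ) : Set (CadlagPath E) :=
  {x | (∀ t, x.toFun t ∈ B) ∧ ∀ m, ∃ S, IsBreakSet S x.toFun (T m) (δ m) (ε m)}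

/-- An ultrafilter on these paths has a pointwise limit `y`, because `B` is compact, and limits `L
m` of the break sets. The values of `y` at the limiting break points are arbitrary, so the candidate
limit is the right-limit regularization `z` of `y`. It has the break sets `L m`, and aligning break
points by a time change gives Skorokhod convergence. -/
theorem isCompact_sparseBreakPaths [CompleteSpace E] {B : Set E} (hB : IsCompact B)
    {T δ ε : ℕ → ℝ} (hT : ∀ a η : ℝ, 0 < η → ∃ m, a < T m ∧ ε m < η) (hδ : ∀ m, 0 < δ m) :
    IsCompact (sparseBreakPaths B T δ ε) := by
  rw [isCompact_iff_ultrafilter_le_nhds']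
  intro F hF
  replace hF : ∀ᶠ x in (F : Filter (CadlagPath E)), x ∈ sparseBreakPaths B T δ ε := hF
  have hS : ∀ m (x : CadlagPath E), ∃ S, x ∈ sparseBreakPaths B T δ ε →
      IsBreakSet S x.toFun (T m) (δ m) (ε m) := by
    intro m x
    by_cases h : x ∈ sparseBreakPaths B T δ ε
    · obtain ⟨S, hS⟩ := h.2 m
      exact ⟨S, fun _ => hS⟩
    · exact ⟨∅, fun h' => (h h').elim⟩
  choose S hS using hS
  have hy : ∀ t : ℝ≥0, ∃ b ∈ B,
      Tendsto (fun x : CadlagPath E => x.toFun t) (F : Filter (CadlagPath E)) (𝓝 b) := by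
    intro t
    have := hB.ultrafilter_le_nhds' (F.map fun x : CadlagPath E => x.toFun t)
      (Ultrafilter.mem_map.2 (hF.mono fun x hx => hx.1 t))
    simpa [Tendsto] using this
  choose y hyB hy using hy
  set L : ℕ → Set ℝ≥0 := fun m => limitSet (F : Filter (CadlagPath E)) (S m) with hL
  have hLs : ∀ m, IsSparse (L m) (δ m) := fun m =>
    isSparse_limitSet (hF.mono fun x hx => (hS m x hx).sparse)
  have hyosc : ∀ m (t t' : ℝ≥0), (t : ℝ) < T m → (t' : ℝ) < T m → t ≤ t' →
      (∀ s ∈ L m, ¬ (t ≤ s ∧ s ≤ t')) → dist (y t) (y t') ≤ ε m := by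
    intro m t t' ht ht' htt' hs
    refine le_of_tendsto ((hy t).dist (hy t')) ?_
    have := eventually_disjoint_of_limitSet F (S m) (isCompact_Icc (a := t) (b := t'))
      fun s hs' hsL => hs s hsL hs'
    filter_upwards [this, hF] with x hx hxK
    refine (hS m x hxK).dist_le t t' ht ht' fun s hsS => ⟨fun h => h.trans htt', fun h => ?_⟩
    by_contra hlt
    exact hx s hsS ⟨(not_le.1 hlt).le, h⟩
  have hgap := fun m t => (hLs m).exists_right_gap (hδ m) t
  choose z hyz using exists_tendsto_nhdsGT hT hgap hyosc
  -- A break point at `t` itself is now allowed: shifting both ends to the right by `h` moves it out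
  -- of the interval, and for small `h` no new one comes in after `t'`.
  have hzosc : ∀ m (t t' : ℝ≥0), (t' : ℝ) < T m → t ≤ t' →
      (∀ s ∈ L m, ¬ (t < s ∧ s ≤ t')) → dist (z t) (z t') ≤ ε m := by
    intro m t t' ht' htt' hs
    have h1 := ((hyz t).comp (tendsto_add_right_nhdsGT t)).dist
      ((hyz t').comp (tendsto_add_right_nhdsGT t'))
    refine le_of_tendsto h1 ?_
    obtain ⟨u, hu, huL⟩ := hgap m t'
    have ev1 : ∀ᶠ h in 𝓝[>] (0 : ℝ≥0), t' + h < u :=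
      (tendsto_add_right_nhdsGT t').eventually (mem_of_superset (Ioo_mem_nhdsGT hu) fun _ => And.right)
    have ev2 : ∀ᶠ h in 𝓝[>] (0 : ℝ≥0), ((t' + h : ℝ≥0) : ℝ) < T m := by
      have : ∀ᶠ a : ℝ≥0 in 𝓝[>] t', (a : ℝ) < T m :=
        nhdsWithin_le_nhds (NNReal.continuous_coe.tendsto t' |>.eventually (gt_mem_nhds ht'))
      exact (tendsto_add_right_nhdsGT t').eventually this
    filter_upwards [ev1, ev2, self_mem_nhdsWithin] with h hh1 hh2 hh3
    refine hyosc m _ _ (lt_of_le_of_lt ?_ hh2) hh2 (add_le_add_left htt' h) fun s hsL hst => ?_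
    · exact NNReal.coe_le_coe.2 (add_le_add_left htt' h)
    · rcases le_or_gt s t' with hle | hlt
      · exact hs s hsL ⟨(lt_add_of_pos_right t hh3).trans_le hst.1, hle⟩
      · exact absurd (huL s hsL hlt) (not_le.2 (hst.2.trans_lt hh1))
  have hzB : ∀ m, IsBreakSet (L m) z (T m) (δ m) (ε m) := by
    refine fun m => ⟨hLs m, fun t t' ht ht' hs => ?_⟩
    rcases le_total t t' with h | h
    · exact hzosc m t t' ht' h fun s hsL hst => absurd ((hs s hsL).2 hst.2) (not_le.2 hst.1)
    · rw [dist_comm]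
      exact hzosc m t' t ht h fun s hsL hst => absurd ((hs s hsL).1 hst.2) (not_le.2 hst.1)
  have hyzd : ∀ m (q : ℝ≥0), (q : ℝ) < T m → q ∉ L m → dist (y q) (z q) ≤ ε m := by
    intro m q hq hqL
    refine le_of_tendsto (tendsto_const_nhds.dist (hyz q)) ?_
    obtain ⟨u, hu, huL⟩ := hgap m q
    have ev2 : ∀ᶠ h : ℝ≥0 in 𝓝[>] q, (h : ℝ) < T m :=
      nhdsWithin_le_nhds (NNReal.continuous_coe.tendsto q |>.eventually (gt_mem_nhds hq))
    filter_upwards [Ioo_mem_nhdsGT hu, ev2] with h hh hh2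
    refine hyosc m q h hq hh2 hh.1.le fun s hsL hst => ?_
    rcases hst.1.eq_or_lt with rfl | hlt
    · exact hqL hsL
    · exact absurd (huL s hsL hlt) (not_le.2 (hst.2.trans_lt hh.2))
  obtain ⟨x, hxz⟩ := exists_cadlagPath hT hδ hzB
  refine ⟨x, ⟨fun t => ?_, fun m => ⟨L m, hxz ▸ hzB m⟩⟩, ?_⟩
  · rw [hxz]
    exact hB.isClosed.mem_of_tendsto (hyz t) (Eventually.of_forall hyB)
  rw [(hasBasis_nhds_cadlagPath x).ge_iff]
  rintro ⟨T₀, η⟩ hη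
  simp only at hη
  -- Four errors below `η / 4`: from `x'` to `y` and from `y` to `z` at the test point, and one
  -- oscillation of each of `x'` and `z`. The horizon exceeds `T₀ + 2` so that the test points stay
  -- before it.
  obtain ⟨m, hm, hmη⟩ := hT (T₀ + 2) (η / 4) (by linarith)
  set δ' := min (δ m) 1 with hδ'
  have hδ'0 : 0 < δ' := lt_min (hδ m) one_pos
  -- The time change moves the relevant times, at most `2 * T₀`, by at most a fraction `κ`; this
  -- must stay below both `η` and `1`.
  set κ : ℝ≥0 := min (1 / 2) (min (⟨η, hη.le⟩) 1 / (4 * (T₀ + 1))) with hκ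
  have hκ0 : 0 < κ := lt_min (by norm_num) (div_pos (lt_min hη one_pos) (by positivity))
  have hκ0' : (0 : ℝ) < κ := hκ0
  have hκ2 : (κ : ℝ) ≤ 1 / 2 := by
    have : κ ≤ 1 / 2 := min_le_left _ _
    exact_mod_cast this
  have hκT : 2 * (κ : ℝ) * T₀ < min η 1 := by
    have h1 : κ ≤ min (⟨η, hη.le⟩) 1 / (4 * (T₀ + 1)) := min_le_right _ _
    have h2 : (κ : ℝ) ≤ min η 1 / (4 * (T₀ + 1)) := by
      have := NNReal.coe_le_coe.2 h1
      push_cast at this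
      exact this
    rw [le_div_iff₀ (by positivity)] at h2
    have := T₀.coe_nonneg
    nlinarith
  set r : ℝ := κ * δ' / 2 with hr
  have hr0 : 0 < r := by positivity
  have hfin := (hLs m).finite_inter_Iic (hδ m) (T₀ + 1)
  have ev1 : ∀ᶠ x' in (F : Filter (CadlagPath E)), ∀ s ∈ L m ∩ Set.Iic (T₀ + 1),
      ∃ s' ∈ S m x', dist s' s < r :=
    (eventually_all_finite hfin).2 fun s hs => hs.1 r hr0
  -- Applied to `[0, T₀]` without the `r`-balls around `L m`, this says that every break point of
  -- `x'` up to `T₀` is eventually close to one of `z`.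
  have ev2 := eventually_disjoint_of_limitSet F (S m)
    (C := Set.Icc 0 T₀ \ ⋃ s ∈ L m, Metric.ball s r)
    (isCompact_Icc.diff (isOpen_biUnion fun _ _ => Metric.isOpen_ball)) fun s hs hsL =>
      hs.2 (Set.mem_biUnion hsL (Metric.mem_ball_self hr0))
  let q : ℝ≥0 → ℝ≥0 := fun s => s + ⟨δ' / 2, by positivity⟩
  have hqc : ∀ s, (q s : ℝ) = s + δ' / 2 := fun s => rfl
  have ev3 : ∀ᶠ x' in (F : Filter (CadlagPath E)), ∀ s ∈ insert 0 (L m ∩ Set.Iic (T₀ + 1)),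
      dist (x'.toFun (q s)) (y (q s)) < η / 4 :=
    (eventually_all_finite (hfin.insert 0)).2 fun s _ =>
      (hy (q s)).eventually (Metric.ball_mem_nhds _ (by linarith))
  filter_upwards [hF, ev1, ev2, ev3] with x' hx' h1 h2 h3
  rw [hxz]
  have hb1 : IsBreakSet (S m x') x'.toFun (T m) δ' (ε m) :=
    ⟨(hS m x' hx').sparse.mono (min_le_left _ _), (hS m x' hx').dist_le⟩
  have hb2 : IsBreakSet (L m) z (T m) δ' (ε m) :=
    ⟨(hLs m).mono (min_le_left _ _), (hzB m).dist_le⟩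
  refine exists_timeChange hb1 hb2 hδ'0 (min_le_right _ _) hm hκ2 hr hκT
    (fun s hs hsT => h1 s ⟨hs, hsT⟩) (fun s' hs' hsT => ?_) fun s hs hsT q' hq' => ?_
  · have := h2 s' hs'
    simp only [Set.mem_sdiff, Set.mem_Icc, zero_le, hsT, and_self, true_and, not_not,
      Set.mem_iUnion, Metric.mem_ball, exists_prop] at this
    exact this
  · have hqq : q' = q s := NNReal.coe_injective (hq'.trans (hqc s).symm)
    rw [hqq]
    have d1 := h3 s (hs.imp id fun h => ⟨h, hsT⟩)
    have hsT' : (s : ℝ) ≤ T₀ + 1 := by exact_mod_cast hsT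
    have hδ1 : δ' ≤ 1 := min_le_right _ _
    have d2 : dist (y (q s)) (z (q s)) ≤ ε m := by
      refine hyzd m _ (by rw [hqc]; linarith) fun hqL => ?_
      rcases hs with rfl | hs
      · have := hb2.sparse.1 _ hqL
        rw [hqc, NNReal.coe_zero] at this
        linarith
      · have := hb2.sparse.2 _ hs _ hqL (by rw [← NNReal.coe_lt_coe, hqc]; linarith)
        rw [hqc] at this
        linarith
    linarith [dist_triangle (x'.toFun (q s)) (y (q s)) (z (q s))]

end Compactness

/-! ### Greedy subdivision of a sequence -/

section Resets

variable {E : Type*} [PseudoMetricSpace E]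

open Classical in
/-- The reference point at time `k` of the greedy subdivision of the sequence `x`: it is reset to
the current value whenever the sequence has moved away from it by more than `ε`. -/
noncomputable def refPoint (ε : ℝ) (x : ℕ → E) : ℕ → E
  | 0 => x 0
  | k + 1 => if ε < dist (x (k + 1)) (refPoint ε x k) then x (k + 1) else refPoint ε x k

/-- The reference point is reset at time `k + 1`. -/
def IsReset (ε : ℝ) (x : ℕ → E) (k : ℕ) : Prop := ε < dist (x (k + 1)) (refPoint ε x k)

open Classical in
/-- The time elapsed at time `k` since the last reset, or since time `0`. -/
noncomputable def resetAge (ε : ℝ) (x : ℕ → E) : ℕ → ℕ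
  | 0 => 0
  | k + 1 => if IsReset ε x k then 0 else resetAge ε x k + 1

variable {ε : ℝ} {x : ℕ → E} {k : ℕ}

theorem refPoint_succ_of_isReset (h : IsReset ε x k) : refPoint ε x (k + 1) = x (k + 1) :=
  if_pos h

theorem refPoint_succ_of_not_isReset (h : ¬ IsReset ε x k) :
    refPoint ε x (k + 1) = refPoint ε x k :=
  if_neg h

theorem resetAge_succ_of_isReset (h : IsReset ε x k) : resetAge ε x (k + 1) = 0 :=
  if_pos h

theorem resetAge_succ_of_not_isReset (h : ¬ IsReset ε x k) :
    resetAge ε x (k + 1) = resetAge ε x k + 1 :=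
  if_neg h

theorem dist_refPoint_le (hε : 0 ≤ ε) (x : ℕ → E) (k : ℕ) : dist (x k) (refPoint ε x k) ≤ ε := by
  rcases k with _ | k
  · simpa [refPoint] using hε
  · by_cases h : IsReset ε x k
    · rw [refPoint_succ_of_isReset h, dist_self]; exact hε
    · rw [refPoint_succ_of_not_isReset h]; exact not_lt.1 h

theorem resetAge_le (ε : ℝ) (x : ℕ → E) (k : ℕ) : resetAge ε x k ≤ k := by
  induction k with
  | zero => simp [resetAge]
  | succ k ih =>
    by_cases h : IsReset ε x k
    · simp [resetAge_succ_of_isReset h]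
    · rw [resetAge_succ_of_not_isReset h]; omega

/-- The reset indexed by `j` takes effect at time `j + 1`, hence the shift: a lower bound on the age
at the next reset gives a lower bound on the spacing. -/
theorem resetAge_add_le {j : ℕ} (hj : IsReset ε x j) (hjk : j < k) :
    resetAge ε x k + (j + 1) ≤ k := by
  induction k with
  | zero => omega
  | succ k ih =>
    by_cases h : IsReset ε x k
    · rw [resetAge_succ_of_isReset h]; omega
    · rw [resetAge_succ_of_not_isReset h]
      have : j ≠ k := fun e => h (e ▸ hj)
      have := ih (by omega)
      omega

theorem refPoint_eq_of_forall_not_isReset {a b : ℕ} (hab : a ≤ b)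
    (h : ∀ k, a ≤ k → k < b → ¬ IsReset ε x k) : refPoint ε x b = refPoint ε x a := by
  induction b, hab using Nat.le_induction with
  | base => rfl
  | succ b hab ih =>
    rw [refPoint_succ_of_not_isReset (h b hab (Nat.lt_succ_self b))]
    exact ih fun k hk hkb => h k hk (hkb.trans (Nat.lt_succ_self b))

/-- If successive resets are far apart then the step path has a sparse break set. -/
theorem isBreakSet_stepPath {n N h : ℕ} {T δ : ℝ} (hn : 1 ≤ n) (hε : 0 ≤ ε) (hN : T * n ≤ N)
    (hδ : δ * n ≤ h + 1) (hx : ∀ k < N, IsReset ε x k → h ≤ resetAge ε x k) :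
    IsBreakSet {s : ℝ≥0 | ∃ k < N, IsReset ε x k ∧ s = ((k + 1 : ℕ) : ℝ≥0) / n}
      (stepPath n x).toFun T δ (2 * ε) := by
  have hn0 : (0 : ℝ) < n := by exact_mod_cast hn
  have hn0' : (0 : ℝ≥0) < n := by exact_mod_cast hn
  have key : ∀ t t' : ℝ≥0, (t' : ℝ) < T → ⌊(n : ℝ≥0) * t⌋₊ ≤ ⌊(n : ℝ≥0) * t'⌋₊ →
      (∀ s ∈ {s : ℝ≥0 | ∃ k < N, IsReset ε x k ∧ s = ((k + 1 : ℕ) : ℝ≥0) / n},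
        s ≤ t' → s ≤ t) → dist ((stepPath n x).toFun t) ((stepPath n x).toFun t') ≤ 2 * ε := by
    intro t t' ht' hle hs
    have href : refPoint ε x ⌊(n : ℝ≥0) * t'⌋₊ = refPoint ε x ⌊(n : ℝ≥0) * t⌋₊ := by
      refine refPoint_eq_of_forall_not_isReset hle fun k hk hk' hreset => ?_
      have h1 : ((k + 1 : ℕ) : ℝ≥0) ≤ n * t' := (Nat.le_floor_iff zero_le).1 hk'
      have hkN : k < N := by
        have h2 : ((k + 1 : ℕ) : ℝ) ≤ n * t' := by exact_mod_cast h1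
        have h3 : ((k + 1 : ℕ) : ℝ) < N := by nlinarith
        have : k + 1 < N := by exact_mod_cast h3
        omega
      have h4 := hs _ ⟨k, hkN, hreset, rfl⟩ (by
        rw [div_le_iff₀ hn0', mul_comm]; exact h1)
      rw [div_le_iff₀ hn0', mul_comm] at h4
      have h5 := Nat.le_floor h4
      omega
    have d1 := dist_refPoint_le hε x ⌊(n : ℝ≥0) * t⌋₊
    have d2 := dist_refPoint_le hε x ⌊(n : ℝ≥0) * t'⌋₊
    rw [href] at d2
    have d3 := dist_triangle_right (x ⌊(n : ℝ≥0) * t⌋₊) (x ⌊(n : ℝ≥0) * t'⌋₊)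
      (refPoint ε x ⌊(n : ℝ≥0) * t⌋₊)
    change dist (x _) (x _) ≤ _
    linarith
  refine ⟨⟨?_, ?_⟩, ?_⟩
  · rintro _ ⟨k, hk, hreset, rfl⟩
    push_cast
    rw [le_div_iff₀ hn0]
    have h1 : (h : ℝ) ≤ k := by exact_mod_cast (hx k hk hreset).trans (resetAge_le ε x k)
    linarith
  · rintro _ ⟨k, hk, hreset, rfl⟩ _ ⟨k', hk', hreset', rfl⟩ hlt
    have hlt' : k < k' := by
      rw [div_lt_div_iff_of_pos_right hn0', Nat.cast_lt] at hlt
      omega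
    have h1 : h + (k + 1) ≤ k' :=
      (Nat.add_le_add_right (hx k' hk' hreset') _).trans (resetAge_add_le hreset hlt')
    have h2 : (h : ℝ) + (k + 1) ≤ k' := by exact_mod_cast h1
    push_cast
    rw [← sub_nonneg]
    have h3 : ((k' : ℝ) + 1) / n - ((k + 1) / n + δ) = ((k' + 1) - (k + 1) - δ * n) / n := by
      field_simp
      ring
    rw [h3]
    exact div_nonneg (by linarith) hn0.le
  · intro t t' ht ht' hs
    rcases le_total ⌊(n : ℝ≥0) * t⌋₊ ⌊(n : ℝ≥0) * t'⌋₊ with hle | hle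
    · exact key t t' ht' hle fun s hsS => (hs s hsS).2
    · rw [dist_comm]
      exact key t' t ht hle fun s hsS => (hs s hsS).1

-- Each reset, and the start, can account for at most `h` times of age below `h`.
open Classical in
theorem sum_resetAge_lt_le (ε : ℝ) (x : ℕ → E) (h N : ℕ) :
    ∑ k ∈ Finset.range N, (if resetAge ε x k < h then (1 : ℝ) else 0) ≤
      h * (1 + ∑ k ∈ Finset.range N, if IsReset ε x k then (1 : ℝ) else 0) := by
  -- The truncated difference `h - resetAge ε x N` is what remains of the quota opened by the last
  -- reset; with it the induction closes.
  suffices H : ∑ k ∈ Finset.range N, (if resetAge ε x k < h then (1 : ℝ) else 0) +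
      ((h - resetAge ε x N : ℕ) : ℝ) ≤
      h * (1 + ∑ k ∈ Finset.range N, if IsReset ε x k then (1 : ℝ) else 0) from
    (le_add_of_nonneg_right (Nat.cast_nonneg _)).trans H
  induction N with
  | zero => simp [resetAge]
  | succ N ih =>
    rw [Finset.sum_range_succ, Finset.sum_range_succ]
    by_cases hr : IsReset ε x N
    · rw [resetAge_succ_of_isReset hr, if_pos hr, Nat.sub_zero]
      have : (if resetAge ε x N < h then (1 : ℝ) else 0) ≤ ((h - resetAge ε x N : ℕ) : ℝ) := by
        split_ifs with hlt
        · have : 1 ≤ h - resetAge ε x N := by omega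
          exact_mod_cast this
        · exact Nat.cast_nonneg _
      linarith
    · rw [resetAge_succ_of_not_isReset hr, if_neg hr]
      have : (if resetAge ε x N < h then (1 : ℝ) else 0) + ((h - (resetAge ε x N + 1) : ℕ) : ℝ) ≤
          ((h - resetAge ε x N : ℕ) : ℝ) := by
        split_ifs with hlt
        · have : 1 + (h - (resetAge ε x N + 1)) = h - resetAge ε x N := by omega
          exact_mod_cast this.le
        · rw [zero_add]
          exact_mod_cast (by omega : h - (resetAge ε x N + 1) ≤ h - resetAge ε x N)
      linarith

end Resets

/-! ### Functions of finitely many outcomes -/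

section KnownAt

variable {ι : Type*} {β γ : Type*}

/-- The quantity `f` depends only on the first `k` outcomes. -/
def KnownAt (k : ℕ) (f : (ℕ → ι) → β) : Prop := DependsOn f (Set.Iio k)

theorem KnownAt.mono {k l : ℕ} {f : (ℕ → ι) → β} (h : KnownAt k f) (hkl : k ≤ l) : KnownAt l f :=
  fun _ _ hω => h fun i hi => hω i (lt_of_lt_of_le hi hkl)

theorem knownAt_const (k : ℕ) (b : β) : KnownAt k (fun _ : ℕ → ι => b) := fun _ _ _ => rfl

theorem KnownAt.comp {k : ℕ} {f : (ℕ → ι) → β} (h : KnownAt k f) (g : β → γ) :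
    KnownAt k fun ω => g (f ω) := fun _ _ hω => congrArg g (h hω)

theorem KnownAt.comp₂ {β' : Type*} {k : ℕ} {f : (ℕ → ι) → β} {f' : (ℕ → ι) → β'}
    (h : KnownAt k f) (h' : KnownAt k f') (g : β → β' → γ) : KnownAt k fun ω => g (f ω) (f' ω) :=
  fun _ _ hω => congrArg₂ g (h hω) (h' hω)

/-- For a finite alphabet this factorization through words of length `k` makes measurability and
integrability automatic. -/
theorem KnownAt.exists_eq_comp [Nonempty ι] {k : ℕ} {f : (ℕ → ι) → β} (h : KnownAt k f) :
    ∃ g : (Fin k → ι) → β, ∀ ω, f ω = g fun j => ω j := by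
  refine ⟨fun i => f fun j => if hj : j < k then i ⟨j, hj⟩ else Classical.arbitrary ι,
    fun ω => h fun j hj => ?_⟩
  have : j < k := hj
  simp [this]

variable [Finite ι] [Nonempty ι] [MeasurableSpace ι] [MeasurableSingletonClass ι]

theorem KnownAt.measurable [MeasurableSpace β] {k : ℕ} {f : (ℕ → ι) → β} (h : KnownAt k f) :
    Measurable f := by
  obtain ⟨g, hg⟩ := h.exists_eq_comp
  have : f = g ∘ fun ω j => ω (j : Fin k) := funext hg
  rw [this]
  exact (measurable_of_finite g).comp (by fun_prop)

theorem KnownAt.integrable {k : ℕ} {f : (ℕ → ι) → ℝ} (h : KnownAt k f) (Q : Measure (ℕ → ι))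
    [IsFiniteMeasure Q] : Integrable f Q := by
  obtain ⟨g, hg⟩ := h.exists_eq_comp
  obtain ⟨C, hC⟩ := (Set.finite_range fun i => ‖g i‖).bddAbove
  refine Integrable.of_bound h.measurable.aestronglyMeasurable C
    (Eventually.of_forall fun ω => ?_)
  rw [hg]
  exact hC ⟨_, rfl⟩

end KnownAt

/-! ### Consequences of the one-step inequality -/

section Increments

variable {ι : Type*} [MeasurableSpace ι] {E : Type*} [NormedAddCommGroup E]

/-- The sequence `X` of functions of the outcomes is adapted, bounded by one, and in one step the
conditional mean square distance to any known point of the unit ball grows by at most `c`. -/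
structure HasSmallIncrements (Q : Measure (ℕ → ι)) (X : (ℕ → ι) → ℕ → E) (c : ℝ) : Prop where
  knownAt : ∀ k, KnownAt k fun ω => X ω k
  norm_le : ∀ ω k, ‖X ω k‖ ≤ 1
  step : ∀ (k : ℕ) (f : (ℕ → ι) → ℝ) (Y : (ℕ → ι) → E), KnownAt k f → KnownAt k Y →
    (∀ ω, 0 ≤ f ω) → (∀ ω, ‖Y ω‖ ≤ 1) →
    ∫ ω, f ω * ‖X ω (k + 1) - Y ω‖ ^ 2 ∂Q ≤ ∫ ω, f ω * ‖X ω k - Y ω‖ ^ 2 ∂Q + c * ∫ ω, f ω ∂Q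

variable {Q : Measure (ℕ → ι)} {X : (ℕ → ι) → ℕ → E} {c : ℝ}

theorem HasSmallIncrements.integral_le (hX : HasSmallIncrements Q X c) {k : ℕ}
    {f : (ℕ → ι) → ℝ} {Y : (ℕ → ι) → E} (hf : KnownAt k f) (hY : KnownAt k Y)
    (hf0 : ∀ ω, 0 ≤ f ω) (hY1 : ∀ ω, ‖Y ω‖ ≤ 1) (m : ℕ) :
    ∫ ω, f ω * ‖X ω (k + m) - Y ω‖ ^ 2 ∂Q ≤
      ∫ ω, f ω * ‖X ω k - Y ω‖ ^ 2 ∂Q + c * m * ∫ ω, f ω ∂Q := by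
  induction m with
  | zero => simp
  | succ m ih =>
    have := hX.step (k + m) f Y (hf.mono (Nat.le_add_right _ _)) (hY.mono (Nat.le_add_right _ _))
      hf0 hY1
    rw [← add_assoc]
    push_cast
    linarith

/-- The iterated inequality is used twice: from `k` on with the earlier squared increment as weight
and `Y = X_k`, then from `j` on with weight `1` and `Y = X_j`. Both initial distances vanish. -/
theorem HasSmallIncrements.integral_sq_mul_sq_le [IsProbabilityMeasure Q]
    (hX : HasSmallIncrements Q X c) (hc : 0 ≤ c) {j k l : ℕ} (hjk : j ≤ k) (hkl : k ≤ l) :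
    ∫ ω, ‖X ω l - X ω k‖ ^ 2 * ‖X ω k - X ω j‖ ^ 2 ∂Q ≤ (c * (l - k)) * (c * (k - j)) := by
  obtain ⟨m, rfl⟩ := Nat.exists_eq_add_of_le hkl
  obtain ⟨i, rfl⟩ := Nat.exists_eq_add_of_le hjk
  have h1 := hX.integral_le (k := j + i) (f := fun ω => ‖X ω (j + i) - X ω j‖ ^ 2)
    (Y := fun ω => X ω (j + i))
    ((hX.knownAt _).comp₂ ((hX.knownAt j).mono (Nat.le_add_right _ _)) fun a b => ‖a - b‖ ^ 2)
    (hX.knownAt _) (fun ω => by positivity) (fun ω => hX.norm_le _ _) m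
  have h2 := hX.integral_le (k := j) (f := fun _ => 1) (Y := fun ω => X ω j)
    (knownAt_const _ _) (hX.knownAt _) (fun ω => zero_le_one) (fun ω => hX.norm_le _ _) i
  simp only [sub_self, norm_zero, ne_eq, OfNat.ofNat_ne_zero, not_false_eq_true, zero_pow,
    mul_zero, integral_zero, zero_add, one_mul, integral_const, probReal_univ, smul_eq_mul,
    mul_one] at h1 h2
  have h3 : ∫ ω, ‖X ω (j + i + m) - X ω (j + i)‖ ^ 2 * ‖X ω (j + i) - X ω j‖ ^ 2 ∂Q =
      ∫ ω, ‖X ω (j + i) - X ω j‖ ^ 2 * ‖X ω (j + i + m) - X ω (j + i)‖ ^ 2 ∂Q := by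
    simp only [mul_comm]
  rw [h3]
  refine h1.trans ?_
  push_cast
  rw [add_sub_cancel_left, add_sub_cancel_left]
  gcongr

theorem HasSmallIncrements.knownAt_refPoint (hX : HasSmallIncrements Q X c) (ε : ℝ) (k : ℕ) :
    KnownAt k fun ω => refPoint ε (X ω) k := by
  classical
  induction k with
  | zero => exact hX.knownAt 0
  | succ k ih =>
    exact (hX.knownAt (k + 1)).comp₂ (ih.mono k.le_succ) fun a b => if ε < dist a b then a else b

theorem HasSmallIncrements.knownAt_isReset (hX : HasSmallIncrements Q X c) (ε : ℝ) (k : ℕ) :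
    KnownAt (k + 1) fun ω => IsReset ε (X ω) k :=
  (hX.knownAt (k + 1)).comp₂ ((hX.knownAt_refPoint ε k).mono k.le_succ) fun a b => ε < dist a b

theorem HasSmallIncrements.knownAt_resetAge (hX : HasSmallIncrements Q X c) (ε : ℝ) (k : ℕ) :
    KnownAt k fun ω => resetAge ε (X ω) k := by
  classical
  induction k with
  | zero => exact knownAt_const _ _
  | succ k ih =>
    exact (hX.knownAt_isReset ε k).comp₂ (ih.mono k.le_succ) fun p a => if p then 0 else a + 1

theorem HasSmallIncrements.norm_refPoint_le (hX : HasSmallIncrements Q X c) (ε : ℝ) (ω : ℕ → ι)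
    (k : ℕ) : ‖refPoint ε (X ω) k‖ ≤ 1 := by
  induction k with
  | zero => exact hX.norm_le ω 0
  | succ k ih =>
    by_cases h : IsReset ε (X ω) k
    · rw [refPoint_succ_of_isReset h]; exact hX.norm_le _ _
    · rwa [refPoint_succ_of_not_isReset h]

-- A reset brings the squared distance to the reference point from at least `ε ^ 2` down to zero;
-- otherwise nothing changes.
open Classical in
theorem sq_dist_refPoint_succ_le {ε : ℝ} (hε : 0 ≤ ε) (x : ℕ → E) (k : ℕ) :
    ‖x (k + 1) - refPoint ε x (k + 1)‖ ^ 2 + ε ^ 2 * (if IsReset ε x k then 1 else 0) ≤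
      ‖x (k + 1) - refPoint ε x k‖ ^ 2 := by
  by_cases h : IsReset ε x k
  · rw [refPoint_succ_of_isReset h, if_pos h, sub_self, norm_zero, ← dist_eq_norm]
    have : ε ≤ dist (x (k + 1)) (refPoint ε x k) := le_of_lt h
    have := pow_le_pow_left₀ hε this 2
    linarith
  · rw [refPoint_succ_of_not_isReset h, if_neg h]
    linarith

variable [Finite ι] [Nonempty ι] [MeasurableSingletonClass ι] [IsProbabilityMeasure Q]

-- Energy balance for the squared distance to the reference point: it starts at zero, gains at most
-- `c` per step in mean and pays `ε ^ 2` for each reset.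
open Classical in
theorem HasSmallIncrements.sum_integral_isReset_le (hX : HasSmallIncrements Q X c) {ε : ℝ}
    (hε : 0 ≤ ε) (N : ℕ) :
    ε ^ 2 * ∑ k ∈ Finset.range N, ∫ ω, (if IsReset ε (X ω) k then (1 : ℝ) else 0) ∂Q ≤ c * N := by
  suffices H : ∫ ω, ‖X ω N - refPoint ε (X ω) N‖ ^ 2 ∂Q +
      ε ^ 2 * ∑ k ∈ Finset.range N, ∫ ω, (if IsReset ε (X ω) k then (1 : ℝ) else 0) ∂Q ≤
        c * N from
    (le_add_of_nonneg_left (integral_nonneg fun ω => by positivity)).trans H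
  induction N with
  | zero => simp [refPoint]
  | succ N ih =>
    have h1 := hX.step N (fun _ => 1) (fun ω => refPoint ε (X ω) N) (knownAt_const _ _)
      (hX.knownAt_refPoint ε N) (fun _ => zero_le_one) fun ω => hX.norm_refPoint_le ε ω N
    simp only [one_mul, integral_const, probReal_univ, smul_eq_mul, mul_one] at h1
    have i1 : KnownAt (N + 1) fun ω => ‖X ω (N + 1) - refPoint ε (X ω) (N + 1)‖ ^ 2 :=
      (hX.knownAt _).comp₂ (hX.knownAt_refPoint ε _) fun a b => ‖a - b‖ ^ 2
    have i2 : KnownAt (N + 1) fun ω => if IsReset ε (X ω) N then (1 : ℝ) else 0 :=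
      (hX.knownAt_isReset ε N).comp fun p => if p then 1 else 0
    have i3 : KnownAt (N + 1) fun ω => ‖X ω (N + 1) - refPoint ε (X ω) N‖ ^ 2 :=
      (hX.knownAt _).comp₂ ((hX.knownAt_refPoint ε _).mono N.le_succ) fun a b => ‖a - b‖ ^ 2
    have h2 := integral_mono ((i1.integrable Q).add ((i2.integrable Q).const_mul (ε ^ 2)))
      (i3.integrable Q) fun ω => sq_dist_refPoint_succ_le hε (X ω) N
    simp only [Pi.add_apply] at h2
    rw [integral_add (i1.integrable Q) ((i2.integrable Q).const_mul _), integral_const_mul] at h2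
    rw [Finset.sum_range_succ]
    push_cast
    linarith

-- The same balance, with the energy counted only while the age is below `h`. Without a reset the
-- age grows, so this indicator can only decrease; at a reset the energy vanishes. Hence a gain `c`
-- is charged only at times of age below `h`.
open Classical in
theorem HasSmallIncrements.sum_integral_short_le (hX : HasSmallIncrements Q X c) {ε : ℝ}
    (hε : 0 ≤ ε) (h N : ℕ) :
    ε ^ 2 * ∑ k ∈ Finset.range N,
        ∫ ω, (if IsReset ε (X ω) k ∧ resetAge ε (X ω) k < h then (1 : ℝ) else 0) ∂Q ≤
      c * ∑ k ∈ Finset.range N, ∫ ω, (if resetAge ε (X ω) k < h then (1 : ℝ) else 0) ∂Q := by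
  suffices H : ∫ ω, (if resetAge ε (X ω) N < h then (1 : ℝ) else 0) *
        ‖X ω N - refPoint ε (X ω) N‖ ^ 2 ∂Q +
      ε ^ 2 * ∑ k ∈ Finset.range N,
        ∫ ω, (if IsReset ε (X ω) k ∧ resetAge ε (X ω) k < h then (1 : ℝ) else 0) ∂Q ≤
      c * ∑ k ∈ Finset.range N, ∫ ω, (if resetAge ε (X ω) k < h then (1 : ℝ) else 0) ∂Q from
    (le_add_of_nonneg_left (integral_nonneg fun ω => by positivity)).trans H
  induction N with
  | zero => simp [refPoint]
  | succ N ih =>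
    have hage : ∀ k, KnownAt k fun ω => if resetAge ε (X ω) k < h then (1 : ℝ) else 0 := fun k =>
      (hX.knownAt_resetAge ε k).comp fun a => if a < h then (1 : ℝ) else 0
    have h1 := hX.step N _ (fun ω => refPoint ε (X ω) N) (hage N)
      (hX.knownAt_refPoint ε N) (fun ω => by positivity) fun ω => hX.norm_refPoint_le ε ω N
    have i1 : KnownAt (N + 1) fun ω => (if resetAge ε (X ω) (N + 1) < h then (1 : ℝ) else 0) *
        ‖X ω (N + 1) - refPoint ε (X ω) (N + 1)‖ ^ 2 :=
      (hage (N + 1)).comp₂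
        ((hX.knownAt _).comp₂ (hX.knownAt_refPoint ε _) fun a b => ‖a - b‖ ^ 2) fun a b => a * b
    have i2 : KnownAt (N + 1) fun ω =>
        if IsReset ε (X ω) N ∧ resetAge ε (X ω) N < h then (1 : ℝ) else 0 :=
      (hX.knownAt_isReset ε N).comp₂ ((hX.knownAt_resetAge ε N).mono N.le_succ)
        fun p a => if p ∧ a < h then 1 else 0
    have i3 : KnownAt (N + 1) fun ω => (if resetAge ε (X ω) N < h then (1 : ℝ) else 0) *
        ‖X ω (N + 1) - refPoint ε (X ω) N‖ ^ 2 :=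
      ((hage N).mono N.le_succ).comp₂ ((hX.knownAt _).comp₂
        ((hX.knownAt_refPoint ε _).mono N.le_succ) fun a b => ‖a - b‖ ^ 2) fun a b => a * b
    have h2 := integral_mono ((i1.integrable Q).add ((i2.integrable Q).const_mul (ε ^ 2)))
      (i3.integrable Q) fun ω => by
        have h4 := sq_dist_refPoint_succ_le hε (X ω) N
        simp only [Pi.add_apply]
        by_cases hr : IsReset ε (X ω) N
        · rw [refPoint_succ_of_isReset hr] at h4 ⊢
          rw [if_pos hr] at h4
          simp only [hr, true_and, sub_self, norm_zero, ne_eq, OfNat.ofNat_ne_zero,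
            not_false_eq_true, zero_pow, mul_zero, zero_add] at h4 ⊢
          split_ifs
          · linarith
          · simp
        · rw [refPoint_succ_of_not_isReset hr, resetAge_succ_of_not_isReset hr]
          simp only [hr, false_and, if_false, mul_zero, add_zero]
          gcongr ?_ * _
          split_ifs <;> first | omega | norm_num
    simp only [Pi.add_apply] at h2
    rw [integral_add (i1.integrable Q) ((i2.integrable Q).const_mul _), integral_const_mul] at h2
    rw [Finset.sum_range_succ, Finset.sum_range_succ]
    linarith

/-- Two successive resets are close to each other with small probability. -/
theorem HasSmallIncrements.measureReal_short_le (hX : HasSmallIncrements Q X c) (hc : 0 ≤ c)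
    {ε : ℝ} (hε : 0 < ε) (h N : ℕ) :
    Q.real {ω | ∃ k < N, IsReset ε (X ω) k ∧ resetAge ε (X ω) k < h} ≤
      c * h / ε ^ 2 * (1 + c * N / ε ^ 2) := by
  classical
  have e1 : ∀ k, Q.real {ω | IsReset ε (X ω) k ∧ resetAge ε (X ω) k < h} =
      ∫ ω, (if IsReset ε (X ω) k ∧ resetAge ε (X ω) k < h then (1 : ℝ) else 0) ∂Q := fun k => by
    have hm : MeasurableSet {ω | IsReset ε (X ω) k ∧ resetAge ε (X ω) k < h} := by
      have : KnownAt (k + 1) fun ω => (IsReset ε (X ω) k ∧ resetAge ε (X ω) k < h) :=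
        (hX.knownAt_isReset ε k).comp₂ ((hX.knownAt_resetAge ε k).mono k.le_succ)
          fun p a => p ∧ a < h
      exact measurableSet_setOfPred.2 this.measurable
    rw [← integral_indicator_one hm]
    simp only [Set.indicator_apply, Set.mem_ofPred_eq, Pi.one_apply]
  have e2 : Q.real {ω | ∃ k < N, IsReset ε (X ω) k ∧ resetAge ε (X ω) k < h} ≤
      ∑ k ∈ Finset.range N,
        ∫ ω, (if IsReset ε (X ω) k ∧ resetAge ε (X ω) k < h then (1 : ℝ) else 0) ∂Q := by
    simp only [← e1]
    refine le_trans (measureReal_mono ?_ (measure_ne_top _ _)) (measureReal_biUnion_finset_le _ _)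
    rintro ω ⟨k, hk, hω⟩
    exact Set.mem_biUnion (Finset.mem_coe.2 (Finset.mem_range.2 hk)) hω
  have hage : ∀ k, Integrable (fun ω => if resetAge ε (X ω) k < h then (1 : ℝ) else 0) Q := fun k =>
    ((hX.knownAt_resetAge ε k).comp fun a => if a < h then (1 : ℝ) else 0).integrable Q
  have hres : ∀ k, Integrable (fun ω => if IsReset ε (X ω) k then (1 : ℝ) else 0) Q := fun k =>
    ((hX.knownAt_isReset ε k).comp fun p => if p then (1 : ℝ) else 0).integrable Q
  have e3 : ∑ k ∈ Finset.range N, ∫ ω, (if resetAge ε (X ω) k < h then (1 : ℝ) else 0) ∂Q ≤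
      h * (1 + ∑ k ∈ Finset.range N, ∫ ω, (if IsReset ε (X ω) k then (1 : ℝ) else 0) ∂Q) := by
    rw [← integral_finsetSum _ fun k _ => hage k, ← integral_finsetSum _ fun k _ => hres k]
    have hi := integrable_finsetSum (Finset.range N) fun k _ => hres k
    have := integral_mono (integrable_finsetSum (Finset.range N) fun k _ => hage k)
      (((integrable_const (1 : ℝ)).add hi).const_mul (h : ℝ))
      fun ω => sum_resetAge_lt_le ε (X ω) h N
    simp only [integral_const_mul, Pi.add_apply] at this
    rw [integral_add (integrable_const _) hi] at this
    simpa using this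
  have e4 := hX.sum_integral_short_le hε.le h N
  have e5 := hX.sum_integral_isReset_le hε.le N
  have hε2 : 0 < ε ^ 2 := by positivity
  rw [← le_div_iff₀' hε2] at e4 e5
  -- Union bound, then short resets by young times, young times by all resets, and all resets by `c
  -- * N / ε ^ 2`.
  refine e2.trans (e4.trans ?_)
  calc _ ≤ c * (h * (1 + c * N / ε ^ 2)) / ε ^ 2 := by
        gcongr
        exact e3.trans (by gcongr)
    _ = _ := by ring

end Increments

/-! ### From small increments to the moment bound and tightness -/

section Tightness

variable {ι : Type*} {E : Type*}

/-- Only finitely many terms of a sequence matter for a neighbourhood of its step path. -/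
theorem continuous_stepPath [TopologicalSpace ι] [DiscreteTopology ι] [PseudoMetricSpace E]
    {X : (ℕ → ι) → ℕ → E} (hX : ∀ k, KnownAt k fun ω => X ω k) (n : ℕ) :
    Continuous fun ω => stepPath n (X ω) := by
  rw [continuous_iff_continuousAt]
  intro ω
  refine (hasBasis_nhds_cadlagPath _).tendsto_right_iff.2 ?_
  rintro ⟨T, η⟩ hη
  have hev : ∀ᶠ ω' : ℕ → ι in 𝓝 ω, ∀ i ∈ Set.Iio ⌊(n : ℝ≥0) * T⌋₊, ω' i = ω i :=
    (eventually_all_finite (Set.finite_Iio _)).2 fun i _ =>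
      (continuous_apply i).tendsto ω |>.eventually
        (p := fun a => a = ω i) (by simp [nhds_discrete])
  filter_upwards [hev] with ω' hω'
  refine ⟨OrderIso.refl _, fun t ht => ⟨by simpa using hη, ?_⟩⟩
  have hk : ⌊(n : ℝ≥0) * t⌋₊ ≤ ⌊(n : ℝ≥0) * T⌋₊ := Nat.floor_mono (by
    have : t ≤ T := ht
    gcongr)
  have : X ω' ⌊(n : ℝ≥0) * t⌋₊ = X ω ⌊(n : ℝ≥0) * t⌋₊ :=
    hX _ fun i hi => hω' i (lt_of_lt_of_le hi hk)
  change dist (X ω' ⌊(n : ℝ≥0) * t⌋₊) (X ω ⌊(n : ℝ≥0) * t⌋₊) < η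
  rw [this, dist_self]
  exact hη

variable [MeasurableSpace ι] [NormedAddCommGroup E]

/-- The moment bound for the increments of step paths. -/
theorem HasSmallIncrements.integral_stepPath_le {Q : Measure (ℕ → ι)} [IsProbabilityMeasure Q]
    {X : (ℕ → ι) → ℕ → E} {C : ℝ} {n : ℕ} (hC : 0 ≤ C) (hn : 1 ≤ n)
    (hX : HasSmallIncrements Q X (C / n)) {t₁ t t₂ : ℝ≥0} (h₁ : t₁ < t) (h₂ : t < t₂) :
    ∫ ω, ‖(stepPath n (X ω)).toFun t₂ - (stepPath n (X ω)).toFun t‖ ^ 2 *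
        ‖(stepPath n (X ω)).toFun t - (stepPath n (X ω)).toFun t₁‖ ^ 2 ∂Q ≤
      C ^ 2 * ((t₂ : ℝ) - t₁) ^ 2 := by
  have hn0 : (0 : ℝ) < n := by exact_mod_cast hn
  set j := ⌊(n : ℝ≥0) * t₁⌋₊ with hj
  set k := ⌊(n : ℝ≥0) * t⌋₊ with hk
  set l := ⌊(n : ℝ≥0) * t₂⌋₊ with hl
  have hjk : j ≤ k := Nat.floor_mono (by gcongr)
  have hkl : k ≤ l := Nat.floor_mono (by gcongr)
  refine (hX.integral_sq_mul_sq_le (by positivity) hjk hkl).trans ?_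
  have h3 : (l : ℝ) ≤ n * t₂ := by exact_mod_cast Nat.floor_le (zero_le : 0 ≤ (n : ℝ≥0) * t₂)
  have h4 : (n * t₁ : ℝ) < j + 1 := by exact_mod_cast Nat.lt_floor_add_one ((n : ℝ≥0) * t₁)
  have h5 : ((l : ℝ) - k) * (k - j) ≤ (n * ((t₂ : ℝ) - t₁)) ^ 2 := by
    rcases hjk.eq_or_lt with h | hjk'
    · rw [h, sub_self, mul_zero]; positivity
    rcases hkl.eq_or_lt with h | hkl'
    · rw [h, sub_self, zero_mul]; positivity
    have a1 : (j : ℝ) + 1 ≤ k := by exact_mod_cast hjk'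
    have a2 : (k : ℝ) + 1 ≤ l := by exact_mod_cast hkl'
    -- Rounding costs at most one unit, and `l - j ≥ 2` gives `(l - j) / 2 ≤ l - j - 1`. The product
    -- is then bounded by the square of the half-sum.
    have a3 : ((l : ℝ) - j) / 2 ≤ n * ((t₂ : ℝ) - t₁) := by linarith
    have a4 := pow_le_pow_left₀ (by linarith) a3 2
    nlinarith [sq_nonneg ((l : ℝ) - k - (k - j))]
  calc C / n * (l - k) * (C / n * (k - j)) = (C / n) ^ 2 * (((l : ℝ) - k) * (k - j)) := by ring
    _ ≤ (C / n) ^ 2 * (n * ((t₂ : ℝ) - t₁)) ^ 2 := by gcongr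
    _ = _ := by field_simp

variable [Finite ι] [MeasurableSingletonClass ι]

/-- With the discrete topology on the finite alphabet, `stepPath` becomes continuous in the
outcomes, so Borel measurability needs no description of the Skorokhod σ-algebra. -/
theorem measurable_stepPath {X : (ℕ → ι) → ℕ → E} (hX : ∀ k, KnownAt k fun ω => X ω k) (n : ℕ) :
    Measurable fun ω => stepPath n (X ω) := by
  let _ : TopologicalSpace ι := ⊥
  have : DiscreteTopology ι := ⟨rfl⟩
  have : BorelSpace ι := ⟨by
    rw [borel_eq_top_of_discrete]
    exact eq_top_iff.2 fun s _ => (Set.toFinite s).measurableSet⟩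
  exact (continuous_stepPath hX n).measurable

variable [Nonempty ι]

/-- The sparseness of the break points that has to be allowed for oscillations `ε` before time `T`
in order that at most the probability `a` is lost, uniformly in the mesh size. -/
theorem exists_sparseness {C ε T a : ℝ} (hC : 0 ≤ C) (hε : 0 < ε) (hT : 0 ≤ T) (ha : 0 < a) :
    ∃ δ : ℝ, 0 < δ ∧ ∀ (n : ℕ) (Q : Measure (ℕ → ι)) (X : (ℕ → ι) → ℕ → E), 1 ≤ n →
      IsProbabilityMeasure Q → HasSmallIncrements Q X (C / n) →
      Q.real {ω | ¬ ∃ S, IsBreakSet S (stepPath n (X ω)).toFun T δ (2 * ε)} ≤ a := by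
  -- The probability bound for short resets, with `h = ⌊δ n⌋` and `N = ⌈T n⌉ ≤ (T + 1) n`, is at
  -- most `M * δ`; the factors `n` cancel.
  set M : ℝ := C / ε ^ 2 * (1 + C * (T + 1) / ε ^ 2) with hM
  have hM0 : 0 ≤ M := by positivity
  refine ⟨a / (M + 1), by positivity, fun n Q X hn hQ hX => ?_⟩
  set δ := a / (M + 1) with hδ
  have hn0 : (1 : ℝ) ≤ n := by exact_mod_cast hn
  have hsub : {ω | ¬ ∃ S, IsBreakSet S (stepPath n (X ω)).toFun T δ (2 * ε)} ⊆
      {ω | ∃ k < ⌈T * n⌉₊, IsReset ε (X ω) k ∧ resetAge ε (X ω) k < ⌊δ * n⌋₊} := by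
    intro ω hω
    by_contra hcon
    simp only [Set.mem_ofPred_eq, not_exists, not_and, not_lt] at hcon
    exact hω ⟨_, isBreakSet_stepPath hn hε.le (Nat.le_ceil _) (Nat.lt_floor_add_one _).le hcon⟩
  refine (measureReal_mono hsub (measure_ne_top _ _)).trans
    ((hX.measureReal_short_le (by positivity) hε _ _).trans ?_)
  have h1 : C / n * ⌊δ * n⌋₊ ≤ C * δ := by
    calc C / n * ⌊δ * n⌋₊ ≤ C / n * (δ * n) := by
          gcongr
          exact Nat.floor_le (by positivity)
      _ = C * δ := by field_simp
  have h2 : C / n * ⌈T * n⌉₊ ≤ C * (T + 1) := by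
    calc C / n * ⌈T * n⌉₊ ≤ C / n * ((T + 1) * n) := by
          gcongr
          refine (Nat.ceil_lt_add_one (by positivity)).le.trans ?_
          linarith
      _ = C * (T + 1) := by field_simp
  calc _ ≤ C * δ / ε ^ 2 * (1 + C * (T + 1) / ε ^ 2) := by gcongr
    _ = M * δ := by rw [hM]; ring
    _ ≤ (M + 1) * δ := by
        have : 0 ≤ δ := by positivity
        linarith
    _ = a := by rw [hδ]; field_simp

/-- The laws of the step paths of sequences with small increments are tight. -/
theorem isTightMeasureSet_stepPath [ProperSpace E] {Q : ℕ → Measure (ℕ → ι)}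
    {X : ℕ → (ℕ → ι) → ℕ → E} {C : ℝ} (hC : 0 ≤ C) (hQ : ∀ n, 1 ≤ n → IsProbabilityMeasure (Q n))
    (hX : ∀ n, 1 ≤ n → HasSmallIncrements (Q n) (X n) (C / n)) :
    IsTightMeasureSet {μ : Measure (CadlagPath E) | ∃ n : ℕ, 1 ≤ n ∧
      μ = (Q n).map fun ω => stepPath n (X n ω)} := by
  rw [isTightMeasureSet_iff_exists_isCompact_measure_compl_le]
  intro η hη
  obtain ⟨a, ha0, ha⟩ := ENNReal.exists_pos_sum_of_countable hη.ne' ℕ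
  let e : ℕ → ℝ := fun m => 1 / ((m : ℝ) + 1)
  have he : ∀ m, 0 < e m := fun m => by positivity
  choose δ hδ0 hδ using fun m : ℕ => exists_sparseness (ι := ι) (E := E) hC (he m) m.cast_nonneg
    (NNReal.coe_pos.2 (ha0 m))
  have hT : ∀ b η : ℝ, 0 < η → ∃ m : ℕ, b < m ∧ 2 * e m < η := by
    intro b η hη
    have h1 : Tendsto (fun m => 2 * e m) atTop (𝓝 (2 * 0)) :=
      tendsto_one_div_add_atTop_nhds_zero_nat.const_mul 2
    rw [mul_zero] at h1
    exact ((tendsto_natCast_atTop_atTop.eventually_gt_atTop b).and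
      (h1.eventually (gt_mem_nhds hη))).exists
  have hK := isCompact_sparseBreakPaths (E := E) (isCompact_closedBall (0 : E) 1)
    (T := fun m => m) (ε := fun m => 2 * e m) hT hδ0
  -- The closure is still compact and, being closed, is measurable.
  refine ⟨_, hK.closure, ?_⟩
  rintro _ ⟨n, hn, rfl⟩
  have hXn := hX n hn
  have hQn := hQ n hn
  rw [Measure.map_apply (measurable_stepPath hXn.knownAt n) isClosed_closure.measurableSet.compl]
  refine le_trans (measure_mono (t := ⋃ m : ℕ, {ω | ¬ ∃ S, IsBreakSet S (stepPath n (X n ω)).toFun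
    m (δ m) (2 * e m)}) ?_) ((measure_iUnion_le _).trans (le_trans ?_ ha.le))
  · intro ω hω
    by_contra hcon
    simp only [Set.mem_iUnion, Set.mem_ofPred_eq, not_exists] at hcon
    refine hω (subset_closure ⟨fun t => ?_, fun m => ?_⟩)
    · exact mem_closedBall_zero_iff.2 (hXn.norm_le _ _)
    · by_contra h
      exact hcon m (not_exists.1 h)
  · refine ENNReal.tsum_le_tsum fun m => ?_
    rw [← ENNReal.ofReal_coe_nnreal, ← ofReal_measureReal]
    exact ENNReal.ofReal_le_ofReal (hδ m n (Q n) (X n) hn hQn hXn)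

end Tightness

/-! ### Hilbert–Schmidt estimates -/

section Frobenius

variable {d : Type*} [Fintype d]

/-- The real Hilbert-Schmidt inner product. -/
def hsInner (A B : Matrix d d ℂ) : ℝ := (Aᴴ * B).trace.re

theorem frobenius_norm_sq (A : Matrix d d ℂ) : ‖A‖ ^ 2 = ∑ i, ∑ j, ‖A i j‖ ^ 2 := by
  rw [Matrix.frobenius_norm_def, ← Real.sqrt_eq_rpow, Real.sq_sqrt (by positivity)]
  simp

theorem norm_sq_eq_hsInner (A : Matrix d d ℂ) : ‖A‖ ^ 2 = hsInner A A := by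
  rw [frobenius_norm_sq, hsInner, Matrix.trace, Complex.re_sum, Finset.sum_comm]
  refine Finset.sum_congr rfl fun j _ => ?_
  rw [Matrix.diag_apply, Matrix.mul_apply, Complex.re_sum]
  refine Finset.sum_congr rfl fun i _ => ?_
  rw [Matrix.conjTranspose_apply, ← Complex.normSq_eq_norm_sq, Complex.star_def,
    ← Complex.normSq_eq_conj_mul_self, Complex.ofReal_re]

theorem hsInner_add_left (A A' B : Matrix d d ℂ) :
    hsInner (A + A') B = hsInner A B + hsInner A' B := by
  simp [hsInner, add_mul]

theorem hsInner_smul_left (r : ℝ) (A B : Matrix d d ℂ) :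
    hsInner ((r : ℂ) • A) B = r * hsInner A B := by
  simp [hsInner, Matrix.conjTranspose_smul]

theorem hsInner_sum_left {κ : Type*} (s : Finset κ) (A : κ → Matrix d d ℂ) (B : Matrix d d ℂ) :
    hsInner (∑ a ∈ s, A a) B = ∑ a ∈ s, hsInner (A a) B := by
  simp [hsInner, Matrix.conjTranspose_sum, Finset.sum_mul, Matrix.trace_sum, Complex.re_sum]

theorem norm_entry_le_frobenius (A : Matrix d d ℂ) (i j : d) : ‖A i j‖ ≤ ‖A‖ := by
  refine le_of_sq_le_sq ?_ (norm_nonneg _)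
  rw [frobenius_norm_sq]
  calc ‖A i j‖ ^ 2 ≤ ∑ j, ‖A i j‖ ^ 2 :=
        Finset.single_le_sum (f := fun j => ‖A i j‖ ^ 2) (fun _ _ => by positivity)
          (Finset.mem_univ j)
    _ ≤ _ := Finset.single_le_sum (f := fun i => ∑ j, ‖A i j‖ ^ 2) (fun _ _ => by positivity)
          (Finset.mem_univ i)

theorem norm_trace_le_frobenius (A : Matrix d d ℂ) : ‖A.trace‖ ≤ Fintype.card d * ‖A‖ := by
  refine (norm_sum_le _ _).trans ?_
  refine (Finset.sum_le_sum fun i _ => norm_entry_le_frobenius A i i).trans ?_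
  simp

/-- A crude form of Cauchy–Schwarz; the factor from the dimension is absorbed in the constants. -/
theorem hsInner_le (A B : Matrix d d ℂ) : hsInner A B ≤ Fintype.card d * (‖A‖ * ‖B‖) := by
  refine (Complex.re_le_norm _).trans ((norm_trace_le_frobenius _).trans ?_)
  gcongr
  refine (Matrix.frobenius_norm_mul _ _).trans ?_
  rw [Matrix.frobenius_norm_conjTranspose]

theorem norm_add_sq_hsInner (A B : Matrix d d ℂ) :
    ‖A + B‖ ^ 2 = ‖A‖ ^ 2 + 2 * hsInner A B + ‖B‖ ^ 2 := by
  have h : hsInner B A = hsInner A B := by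
    have : (Bᴴ * A).trace = star (Aᴴ * B).trace := by
      rw [← Matrix.trace_conjTranspose, Matrix.conjTranspose_mul, Matrix.conjTranspose_conjTranspose]
    rw [hsInner, this, Complex.star_def, Complex.conj_re, hsInner]
  simp only [norm_sq_eq_hsInner, hsInner_add_left]
  have h2 : ∀ C : Matrix d d ℂ, hsInner C (A + B) = hsInner C A + hsInner C B := fun C => by
    simp [hsInner, mul_add]
  rw [h2, h2, h]
  ring

-- Write `A = Bᴴ * B`; the norm is submultiplicative and `‖B‖ ^ 2` is the trace of `A`.
open scoped MatrixOrder in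
theorem norm_le_trace_of_posSemidef {A : Matrix d d ℂ} (hA : A.PosSemidef) :
    ‖A‖ ≤ A.trace.re := by
  classical
  obtain ⟨B, rfl⟩ := CStarAlgebra.nonneg_iff_eq_star_mul_self.mp hA.nonneg
  rw [Matrix.star_eq_conjTranspose]
  refine (Matrix.frobenius_norm_mul _ _).trans (le_of_eq ?_)
  rw [Matrix.frobenius_norm_conjTranspose, ← sq, norm_sq_eq_hsInner, hsInner]

theorem IsState.norm_le_one {ρ : Matrix d d ℂ} (hρ : IsState ρ) : ‖ρ‖ ≤ 1 := by
  have := norm_le_trace_of_posSemidef hρ.1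
  rwa [hρ.2, Complex.one_re] at this

theorem PosSemidef.ofReal_re_trace {A : Matrix d d ℂ} (hA : A.PosSemidef) :
    ((A.trace.re : ℝ) : ℂ) = A.trace := by
  refine Complex.ext (by simp) ?_
  simpa using (Complex.le_def.1 hA.trace_nonneg).2

/-- Trace zero forces `A = 0`, so the convention `0⁻¹ = 0` does no harm to normalized states. -/
theorem PosSemidef.trace_smul_inv_smul {A : Matrix d d ℂ} (hA : A.PosSemidef) :
    A.trace • (A.trace⁻¹ • A) = A := by
  by_cases h : A.trace = 0
  · have := norm_le_trace_of_posSemidef hA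
    rw [h, Complex.zero_re] at this
    have : A = 0 := norm_le_zero_iff.1 this
    simp [this]
  · rw [smul_smul, mul_inv_cancel₀ h, one_smul]

theorem PosSemidef.norm_inv_trace_smul_le {A : Matrix d d ℂ} (hA : A.PosSemidef) :
    ‖A.trace⁻¹ • A‖ ≤ 1 := by
  have h1 := norm_le_trace_of_posSemidef hA
  have h0 : 0 ≤ A.trace.re := (norm_nonneg _).trans h1
  rw [norm_smul, norm_inv, ← PosSemidef.ofReal_re_trace hA, Complex.norm_real,
    Real.norm_of_nonneg h0]
  exact inv_mul_le_one_of_le₀ h1 h0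

theorem norm_mul_mul_conjTranspose_le {A ρ B : Matrix d d ℂ} (hρ : ‖ρ‖ ≤ 1) :
    ‖A * ρ * Bᴴ‖ ≤ ‖A‖ * ‖B‖ := by
  calc ‖A * ρ * Bᴴ‖ ≤ ‖A * ρ‖ * ‖Bᴴ‖ := Matrix.frobenius_norm_mul _ _
    _ ≤ ‖A‖ * 1 * ‖B‖ := by
        rw [Matrix.frobenius_norm_conjTranspose]
        gcongr
        exact (Matrix.frobenius_norm_mul _ _).trans (by gcongr)
    _ = _ := by ring

/-- Conjugation by a perturbation of a multiple of the identity. -/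
theorem norm_conj_sub_le [DecidableEq d] {κ : ℂ} {A ρ : Matrix d d ℂ} (hρ : ‖ρ‖ ≤ 1) :
    ‖(κ • 1 + A) * ρ * (κ • 1 + A)ᴴ - ((‖κ‖ ^ 2 : ℝ) : ℂ) • ρ‖ ≤ 2 * ‖κ‖ * ‖A‖ + ‖A‖ ^ 2 := by
  have e : (κ • 1 + A) * ρ * (κ • 1 + A)ᴴ - ((‖κ‖ ^ 2 : ℝ) : ℂ) • ρ =
      κ • (ρ * Aᴴ) + star κ • (A * ρ) + A * ρ * Aᴴ := by
    have : ((‖κ‖ ^ 2 : ℝ) : ℂ) = star κ * κ := by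
      rw [← Complex.normSq_eq_norm_sq, Complex.star_def, Complex.normSq_eq_conj_mul_self]
    rw [this, Matrix.conjTranspose_add, Matrix.conjTranspose_smul, Matrix.conjTranspose_one]
    simp only [add_mul, mul_add, smul_mul_assoc, one_mul, mul_smul_comm, mul_one, smul_smul,
      smul_add]
    abel
  rw [e]
  have h1 : ‖ρ * Aᴴ‖ ≤ ‖A‖ := by
    refine (Matrix.frobenius_norm_mul _ _).trans ?_
    rw [Matrix.frobenius_norm_conjTranspose]
    exact mul_le_of_le_one_left (norm_nonneg _) hρ
  have h2 : ‖A * ρ‖ ≤ ‖A‖ :=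
    (Matrix.frobenius_norm_mul _ _).trans (mul_le_of_le_one_right (norm_nonneg _) hρ)
  have h3 : ‖A * ρ * Aᴴ‖ ≤ ‖A‖ ^ 2 := by
    rw [sq]; exact norm_mul_mul_conjTranspose_le hρ
  refine norm_add₃_le.trans ?_
  rw [norm_smul, norm_smul, norm_star]
  have h4 := mul_le_mul_of_nonneg_left h1 (norm_nonneg κ)
  have h5 := mul_le_mul_of_nonneg_left h2 (norm_nonneg κ)
  linarith

end Frobenius

/-! ### The one-step inequality for a single transition -/

section OneStep

variable {d e : Type*} [Fintype d] [Fintype e]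

/-- The non-normalized transition of the state of `H₀` on observing the event `P`, when the
blocks of the first column of the interaction are `V`. -/
def transition (V : e → Matrix d d ℂ) (P : Matrix e e ℂ) (ρ : Matrix d d ℂ) : Matrix d d ℂ :=
  ∑ z, (∑ j, P z j • V j) * ρ * (∑ j, P z j • V j)ᴴ

theorem transition_posSemidef (V : e → Matrix d d ℂ) (P : Matrix e e ℂ) {ρ : Matrix d d ℂ}
    (hρ : ρ.PosSemidef) : (transition V P ρ).PosSemidef :=
  Matrix.posSemidef_sum _ fun _ _ => hρ.mul_mul_conjTranspose_same _

variable [DecidableEq d]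

theorem transition_smul (V : e → Matrix d d ℂ) (P : Matrix e e ℂ) (r : ℂ) (ρ : Matrix d d ℂ) :
    transition V P (r • ρ) = r • transition V P ρ := by
  simp [transition, Finset.smul_sum]

theorem transition_eq {P : Matrix e e ℂ} (hP : P.IsHermitian) (hP2 : P * P = P)
    (V : e → Matrix d d ℂ) (ρ : Matrix d d ℂ) :
    transition V P ρ = ∑ j, ∑ l, P l j • (V j * ρ * (V l)ᴴ) := by
  have h : ∀ j l, P l j = ∑ z, P z j * star (P z l) := fun j l => by
    conv_lhs => rw [← hP2, Matrix.mul_apply]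
    refine Finset.sum_congr rfl fun z _ => ?_
    rw [mul_comm, hP.apply l z]
  have h' : ∀ j l, P l j • (V j * ρ * (V l)ᴴ) =
      ∑ z, (P z j * star (P z l)) • (V j * ρ * (V l)ᴴ) := fun j l =>
    (congrArg (· • (V j * ρ * (V l)ᴴ)) (h j l)).trans Finset.sum_smul
  refine Eq.trans ?_ (Finset.sum_congr rfl fun j _ => Finset.sum_congr rfl fun l _ => (h' j l).symm)
  simp only [transition, Matrix.conjTranspose_sum, Matrix.conjTranspose_smul, Finset.sum_mul,
    Finset.mul_sum, smul_mul_assoc, mul_smul_comm, Finset.smul_sum, smul_smul]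
  rw [Finset.sum_comm]
  conv_rhs => rw [Finset.sum_comm]
  refine Finset.sum_congr rfl fun l _ => ?_
  rw [Finset.sum_comm]
  refine Finset.sum_congr rfl fun j _ => Finset.sum_congr rfl fun z _ => ?_
  rw [mul_comm]

variable [DecidableEq e]

/-- A transition is linear in the projector, by `transition_eq`, so summing over the outcomes
replaces it by the identity: the mean evolution ignores the measurement. -/
theorem sum_transition {ι : Type*} [Fintype ι] {P : ι → Matrix e e ℂ}
    (hP : ∀ a, (P a).IsHermitian) (hP2 : ∀ a, P a * P a = P a) (hP1 : ∑ a, P a = 1)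
    (V : e → Matrix d d ℂ) (ρ : Matrix d d ℂ) :
    ∑ a, transition V (P a) ρ = ∑ j, V j * ρ * (V j)ᴴ := by
  simp only [fun a => transition_eq (hP a) (hP2 a) V ρ]
  rw [Finset.sum_comm]
  refine Finset.sum_congr rfl fun j _ => ?_
  rw [Finset.sum_comm]
  have h : ∀ l, ∑ a, P a l j = if l = j then 1 else 0 := fun l => by
    rw [← Matrix.one_apply, ← hP1, Matrix.sum_apply]
  simp only [← Finset.sum_smul, h]
  simp

/-- The blocks `V` are those of an interaction of strength `s`, with constant `c`. -/
structure IsWeak (x₀ : e) (c s : ℝ) (V : e → Matrix d d ℂ) : Prop where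
  diag : ‖V x₀ - 1‖ ≤ c * s ^ 2
  off : ∀ j, j ≠ x₀ → ‖V j‖ ≤ c * s

variable {x₀ : e} {c s : ℝ} {V : e → Matrix d d ℂ}

theorem norm_sum_transition_sub_le {ι : Type*} [Fintype ι] {P : ι → Matrix e e ℂ}
    (hP : ∀ a, (P a).IsHermitian) (hP2 : ∀ a, P a * P a = P a) (hP1 : ∑ a, P a = 1)
    (hs0 : 0 ≤ s) (hs1 : s ≤ 1) (hV : IsWeak x₀ c s V) {ρ : Matrix d d ℂ} (hρ : ‖ρ‖ ≤ 1) :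
    ‖∑ a, transition V (P a) ρ - ρ‖ ≤ (2 * c + c ^ 2 + Fintype.card e * c ^ 2) * s ^ 2 := by
  rw [sum_transition hP hP2 hP1, ← Finset.add_sum_erase _ _ (Finset.mem_univ x₀), add_sub_right_comm]
  have h1 := norm_conj_sub_le (κ := 1) (A := V x₀ - 1) hρ
  simp only [one_smul, add_sub_cancel, norm_one, one_pow, Complex.ofReal_one, mul_one] at h1
  have h2 : ‖V x₀ - 1‖ ^ 2 ≤ c ^ 2 * s ^ 2 := by
    calc ‖V x₀ - 1‖ ^ 2 ≤ (c * s ^ 2) ^ 2 := by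
          gcongr; exact hV.diag
      _ = c ^ 2 * s ^ 2 * s ^ 2 := by ring
      _ ≤ c ^ 2 * s ^ 2 * 1 := by
          gcongr; exact pow_le_one₀ hs0 hs1
      _ = _ := mul_one _
  have h3 : ‖∑ j ∈ Finset.univ.erase x₀, V j * ρ * (V j)ᴴ‖ ≤ Fintype.card e * (c ^ 2 * s ^ 2) := by
    refine (norm_sum_le_of_le (f := fun j => V j * ρ * (V j)ᴴ) (n := fun _ => c ^ 2 * s ^ 2) _
      fun j hj => ?_).trans ?_
    · refine (norm_mul_mul_conjTranspose_le hρ).trans ?_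
      have := hV.off j (Finset.ne_of_mem_erase hj)
      have := mul_self_le_mul_self (norm_nonneg _) this
      linarith
    · rw [Finset.sum_const, nsmul_eq_mul]
      gcongr
      exact_mod_cast Finset.card_le_univ _
  refine (norm_add_le _ _).trans ?_
  have := hV.diag
  linarith

/-- The transition is a small perturbation of a multiple of the identity, and it is of second order
if the multiple vanishes. -/
theorem exists_transition_estimate (x₀ : e) {c : ℝ} (hc : 0 ≤ c) (P : Matrix e e ℂ) :
    ∃ b : ℝ, 0 ≤ b ∧ ∀ (s : ℝ) (V : e → Matrix d d ℂ) (ρ : Matrix d d ℂ), 0 ≤ s → s ≤ 1 →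
      IsWeak x₀ c s V → ‖ρ‖ ≤ 1 →
      ‖transition V P ρ - ((∑ z, ‖P z x₀‖ ^ 2 : ℝ) : ℂ) • ρ‖ ≤ b * s ∧
      (∑ z, ‖P z x₀‖ ^ 2 = 0 → ‖transition V P ρ‖ ≤ b * s ^ 2) := by
  set B : e → ℝ := fun z => ∑ j, ‖P z j‖ * c with hB
  have hB0 : ∀ z, 0 ≤ B z := fun z => Finset.sum_nonneg fun j _ => by positivity
  refine ⟨∑ z, (2 * ‖P z x₀‖ * B z + B z ^ 2), Finset.sum_nonneg fun z _ => by
    have := hB0 z; positivity, fun s V ρ hs0 hs1 hV hρ => ?_⟩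
  -- All the `W j` are `O(s)`, and each Kraus operator is `P z x₀ • 1` plus a combination of them.
  -- If the column `P z x₀` vanishes, only terms quadratic in the `W j` survive.
  let W : e → Matrix d d ℂ := fun j => if j = x₀ then V j - 1 else V j
  have hW : ∀ j, ‖W j‖ ≤ c * s := fun j => by
    by_cases h : j = x₀
    · subst h
      simp only [W, if_true]
      refine hV.diag.trans ?_
      have : s ^ 2 ≤ s := by nlinarith
      gcongr
    · simp only [W, h, if_false]
      exact hV.off j h
  set A : e → Matrix d d ℂ := fun z => ∑ j, P z j • W j with hA
  have hA1 : ∀ z, ∑ j, P z j • V j = P z x₀ • 1 + A z := fun z => by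
    rw [hA]
    simp only
    rw [← Finset.add_sum_erase _ _ (Finset.mem_univ x₀),
      ← Finset.add_sum_erase _ (fun j => P z j • W j) (Finset.mem_univ x₀), ← add_assoc]
    congr 1
    · simp only [W, if_true]
      rw [← smul_add, add_sub_cancel]
    · refine Finset.sum_congr rfl fun j hj => ?_
      simp only [W, Finset.ne_of_mem_erase hj, if_false]
  have hAn : ∀ z, ‖A z‖ ≤ B z * s := fun z => by
    rw [hA, hB, Finset.sum_mul]
    refine norm_sum_le_of_le _ fun j _ => ?_
    rw [norm_smul, mul_assoc]
    gcongr
    exact hW j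
  have hAn2 : ∀ z, ‖A z‖ ^ 2 ≤ B z ^ 2 * s ^ 2 := fun z => by
    rw [← mul_pow]
    gcongr
    exact hAn z
  have hs2 : s ^ 2 ≤ s := by nlinarith
  constructor
  · have e1 : transition V P ρ - ((∑ z, ‖P z x₀‖ ^ 2 : ℝ) : ℂ) • ρ =
        ∑ z, ((P z x₀ • 1 + A z) * ρ * (P z x₀ • 1 + A z)ᴴ - ((‖P z x₀‖ ^ 2 : ℝ) : ℂ) • ρ) := by
      rw [Finset.sum_sub_distrib, ← Finset.sum_smul, ← Complex.ofReal_sum]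
      simp only [transition, hA1]
    rw [e1, Finset.sum_mul]
    refine norm_sum_le_of_le _ fun z _ => (norm_conj_sub_le hρ).trans ?_
    have h1 := hAn2 z
    have h2 : B z ^ 2 * s ^ 2 ≤ B z ^ 2 * s := by gcongr
    have h3 : 2 * ‖P z x₀‖ * ‖A z‖ ≤ 2 * ‖P z x₀‖ * (B z * s) := by
      gcongr; exact hAn z
    linarith
  · intro h0
    have h0' : ∀ z, P z x₀ = 0 := fun z => by
      have := (Finset.sum_eq_zero_iff_of_nonneg fun z _ => by positivity).1 h0 z
        (Finset.mem_univ z)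
      simpa using this
    simp only [transition, hA1, h0', zero_smul, zero_add, norm_zero, mul_zero, zero_mul]
    rw [Finset.sum_mul]
    refine norm_sum_le_of_le _ fun z _ => (norm_mul_mul_conjTranspose_le hρ).trans ?_
    rw [← sq]
    exact hAn2 z

/-- The contribution of one outcome to the conditional variance of a transition. -/
theorem exists_variance_bound (x₀ : e) {c : ℝ} (hc : 0 ≤ c) (P : Matrix e e ℂ) :
    ∃ b : ℝ, 0 ≤ b ∧ ∀ (s : ℝ) (V : e → Matrix d d ℂ) (ρ : Matrix d d ℂ), 0 ≤ s → s ≤ 1 →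
      IsWeak x₀ c s V → IsState ρ → (transition V P ρ).trace.re ≤ 1 →
      (transition V P ρ).trace.re *
        ‖(transition V P ρ).trace⁻¹ • transition V P ρ - ρ‖ ^ 2 ≤ b * s ^ 2 := by
  obtain ⟨b, hb, hest⟩ := exists_transition_estimate (d := d) x₀ hc P
  set q : ℝ := ∑ z, ‖P z x₀‖ ^ 2 with hq
  have hq0 : 0 ≤ q := Finset.sum_nonneg fun z _ => by positivity
  set D : ℝ := ((Fintype.card d : ℕ) : ℝ) with hD
  have hD0 : 0 ≤ D := Nat.cast_nonneg _
  set b' : ℝ := b + D * b with hb'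
  -- One summand for each case. If `q = 0`, the probability `p` is `O(s ^ 2)` and the jump at most
  -- `2`. If `p ≥ q / 2`, then `p` times the jump is `O(s)`. If `p < q / 2`, then `s` is bounded
  -- below and the trivial bound `4` suffices. For `q = 0` the quotients are zero in Lean.
  refine ⟨4 * (D * b) + 2 * b' ^ 2 / q + 16 * b' ^ 2 / q ^ 2, by positivity,
    fun s V ρ hs0 hs1 hV hρ hp1 => ?_⟩
  obtain ⟨h1, h2⟩ := hest s V ρ hs0 hs1 hV hρ.norm_le_one
  have hps := transition_posSemidef V P hρ.1
  set Λ := transition V P ρ with hΛ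
  set p := Λ.trace.re with hp
  have hp0 : 0 ≤ p := (Complex.le_def.1 hps.trace_nonneg).1
  have hn1 := PosSemidef.norm_inv_trace_smul_le hps
  have hdiff : ‖Λ.trace⁻¹ • Λ - ρ‖ ^ 2 ≤ 4 := by
    have : ‖Λ.trace⁻¹ • Λ - ρ‖ ≤ 2 := (norm_sub_le _ _).trans (by linarith [hρ.norm_le_one])
    have := pow_le_pow_left₀ (norm_nonneg _) this 2
    linarith
  have n1 : 0 ≤ 4 * (D * b) * s ^ 2 := by positivity
  have n2 : 0 ≤ 2 * b' ^ 2 / q * s ^ 2 := by positivity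
  have n3 : 0 ≤ 16 * b' ^ 2 / q ^ 2 * s ^ 2 := by positivity
  rw [add_mul, add_mul]
  rcases hq0.eq_or_lt with hq00 | hq00
  · have h3 := h2 hq00.symm
    have h4 : p ≤ D * (b * s ^ 2) :=
      (Complex.re_le_norm _).trans ((norm_trace_le_frobenius _).trans (by gcongr))
    have := mul_le_mul h4 hdiff (by positivity) (by positivity)
    linarith
  · have h3 : |p - q| ≤ D * (b * s) := by
      have : ((p - q : ℝ) : ℂ) = (Λ - (q : ℂ) • ρ).trace := by
        rw [Matrix.trace_sub, Matrix.trace_smul, hρ.2, Complex.ofReal_sub, hp,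
          PosSemidef.ofReal_re_trace hps]
        simp
      rw [← Real.norm_eq_abs, ← Complex.norm_real, this]
      exact (norm_trace_le_frobenius _).trans (by gcongr)
    rcases le_or_gt (q / 2) p with hpq | hpq
    · have hp00 : 0 < p := by linarith
      have h4 : ‖Λ - (p : ℂ) • ρ‖ ≤ b' * s := by
        have e1 : Λ - (p : ℂ) • ρ = (Λ - (q : ℂ) • ρ) + ((q - p : ℝ) : ℂ) • ρ := by
          rw [Complex.ofReal_sub, sub_smul]; abel
        rw [e1]
        refine (norm_add_le _ _).trans ?_
        rw [norm_smul, Complex.norm_real, Real.norm_eq_abs, abs_sub_comm]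
        have := mul_le_mul h3 hρ.norm_le_one (norm_nonneg _) (by positivity)
        rw [hb']
        linarith
      have h5 : (p : ℂ) • (Λ.trace⁻¹ • Λ - ρ) = Λ - (p : ℂ) • ρ := by
        rw [smul_sub, hp, PosSemidef.ofReal_re_trace hps, PosSemidef.trace_smul_inv_smul hps]
      have h6 : p * ‖Λ.trace⁻¹ • Λ - ρ‖ ≤ b' * s := by
        rw [← h5, norm_smul, Complex.norm_real, Real.norm_of_nonneg hp0] at h4
        exact h4
      have h7 : p * ‖Λ.trace⁻¹ • Λ - ρ‖ ^ 2 ≤ 2 * b' ^ 2 / q * s ^ 2 := by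
        have h8 := pow_le_pow_left₀ (by positivity) h6 2
        have h9 : p * ‖Λ.trace⁻¹ • Λ - ρ‖ ^ 2 = (p * ‖Λ.trace⁻¹ • Λ - ρ‖) ^ 2 / p := by
          field_simp
        rw [h9]
        calc _ ≤ (b' * s) ^ 2 / (q / 2) := by gcongr
          _ = _ := by field_simp
      linarith
    · have h4 : q / 2 ≤ b' * s := by
        have h5 : 0 ≤ b * s := by positivity
        have := (abs_le.1 h3).1
        rw [hb']
        linarith
      have h6 := pow_le_pow_left₀ (by positivity) h4 2
      have h7 : 4 ≤ 16 * b' ^ 2 / q ^ 2 * s ^ 2 := by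
        rw [div_mul_eq_mul_div, le_div_iff₀ (by positivity)]
        linarith
      have := mul_le_mul hp1 hdiff (by positivity) zero_le_one
      linarith

/-- In one transition the mean square distance to a fixed point of the unit ball grows by at most a
multiple of the squared strength of the interaction. -/
theorem exists_transition_step_bound {ι : Type*} [Fintype ι] (x₀ : e) {c : ℝ} (hc : 0 ≤ c)
    {P : ι → Matrix e e ℂ} (hP : ∀ a, (P a).IsHermitian) (hP2 : ∀ a, P a * P a = P a)
    (hP1 : ∑ a, P a = 1) :
    ∃ C : ℝ, 0 ≤ C ∧ ∀ (s : ℝ) (V : e → Matrix d d ℂ) (ρ Y : Matrix d d ℂ), 0 ≤ s → s ≤ 1 →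
      IsWeak x₀ c s V → IsState ρ → ‖Y‖ ≤ 1 →
      ∑ a, (transition V (P a) ρ).trace.re = 1 →
      ∑ a, (transition V (P a) ρ).trace.re *
        ‖(transition V (P a) ρ).trace⁻¹ • transition V (P a) ρ - Y‖ ^ 2 ≤
          ‖ρ - Y‖ ^ 2 + C * s ^ 2 := by
  choose b hb0 hb using fun a => exists_variance_bound (d := d) x₀ hc (P a)
  set D : ℝ := ((Fintype.card d : ℕ) : ℝ) with hD
  set G : ℝ := 2 * c + c ^ 2 + Fintype.card e * c ^ 2 with hG
  have hG0 : 0 ≤ G := by positivity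
  refine ⟨∑ a, b a + 4 * (D * G), add_nonneg (Finset.sum_nonneg fun a _ => hb0 a) (by positivity),
    fun s V ρ Y hs0 hs1 hV hρ hY hsum => ?_⟩
  have hps := fun a => transition_posSemidef V (P a) hρ.1
  have hp0 : ∀ a, 0 ≤ (transition V (P a) ρ).trace.re := fun a =>
    (Complex.le_def.1 (hps a).trace_nonneg).1
  have hp1 : ∀ a, (transition V (P a) ρ).trace.re ≤ 1 := fun a => by
    rw [← hsum]
    exact Finset.single_le_sum (f := fun a => (transition V (P a) ρ).trace.re)
      (fun a _ => hp0 a) (Finset.mem_univ a)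
  set p : ι → ℝ := fun a => (transition V (P a) ρ).trace.re with hp
  set R : ι → Matrix d d ℂ := fun a =>
    (transition V (P a) ρ).trace⁻¹ • transition V (P a) ρ with hR
  have hpR : ∀ a, (p a : ℂ) • R a = transition V (P a) ρ := fun a => by
    rw [hp, hR]
    simp only
    rw [PosSemidef.ofReal_re_trace (hps a), PosSemidef.trace_smul_inv_smul (hps a)]
  -- Expansion around `ρ`: after summation the cross term sees only the mean drift, which is `O(s ^
  -- 2)`, although single jumps are larger.
  have e1 : ∀ a, p a * ‖R a - Y‖ ^ 2 = p a * ‖R a - ρ‖ ^ 2 +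
      2 * hsInner ((p a : ℂ) • (R a - ρ)) (ρ - Y) + p a * ‖ρ - Y‖ ^ 2 := fun a => by
    have : R a - Y = (R a - ρ) + (ρ - Y) := by abel
    rw [this, norm_add_sq_hsInner, hsInner_smul_left]
    ring
  have e2 : ∑ a, (p a : ℂ) • (R a - ρ) = ∑ a, transition V (P a) ρ - ρ := by
    simp only [smul_sub, hpR]
    rw [Finset.sum_sub_distrib, ← Finset.sum_smul, ← Complex.ofReal_sum, hsum, Complex.ofReal_one,
      one_smul]
  have e3 : ∑ a, p a * ‖R a - Y‖ ^ 2 = ∑ a, p a * ‖R a - ρ‖ ^ 2 +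
      2 * hsInner (∑ a, transition V (P a) ρ - ρ) (ρ - Y) + ‖ρ - Y‖ ^ 2 := by
    simp only [e1]
    rw [Finset.sum_add_distrib, Finset.sum_add_distrib, ← Finset.mul_sum, ← hsInner_sum_left, e2,
      ← Finset.sum_mul, hsum, one_mul]
  have h1 : ∑ a, p a * ‖R a - ρ‖ ^ 2 ≤ (∑ a, b a) * s ^ 2 := by
    rw [Finset.sum_mul]
    exact Finset.sum_le_sum fun a _ => hb a s V ρ hs0 hs1 hV hρ (hp1 a)
  have h2 : hsInner (∑ a, transition V (P a) ρ - ρ) (ρ - Y) ≤ D * (G * s ^ 2 * 2) := by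
    refine (hsInner_le _ _).trans ?_
    gcongr
    · exact norm_sum_transition_sub_le hP hP2 hP1 hs0 hs1 hV hρ.norm_le_one
    · exact (norm_sub_le _ _).trans (by linarith [hρ.norm_le_one])
  rw [e3]
  linarith

end OneStep

/-! ### Reduction of the repeated measurements to transitions on the small system -/

section PartialTrace

variable {d e c : Type*} [Fintype c]

theorem partialTrace_smul (r : ℂ) (W : Matrix (d × c) (d × c) ℂ) :
    partialTrace (r • W) = r • partialTrace W := by
  ext a b
  simp [partialTrace, Finset.mul_sum]

/-- Singling out the last copy, which is joined to the first factor. -/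
def splitLastLeft (d e : Type*) (k : ℕ) : d × (Fin (k + 1) → e) ≃ (d × e) × (Fin k → e) where
  toFun x := ((x.1, x.2 (Fin.last k)), fun j => x.2 j.castSucc)
  invFun y := (y.1.1, Fin.snoc y.2 y.1.2)
  left_inv x := by
    ext
    · rfl
    · simp only
      rw [show (fun j : Fin k => x.2 j.castSucc) = Fin.init x.2 from rfl, Fin.snoc_init_self]
  right_inv y := by simp

theorem partialTrace_submatrix_splitLastLeft [Fintype e] {k : ℕ}
    (Z : Matrix ((d × e) × (Fin k → e)) ((d × e) × (Fin k → e)) ℂ) :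
    partialTrace (Z.submatrix (splitLastLeft d e k) (splitLastLeft d e k)) =
      partialTrace (partialTrace Z) := by
  ext a b
  simp only [partialTrace, Matrix.of_apply, Matrix.submatrix_apply]
  rw [← Fintype.sum_prod_type' fun z w => Z ((a, z), w) ((b, z), w)]
  exact Fintype.sum_equiv (Fin.snocEquiv fun _ => e).symm _ _ fun x => rfl

theorem ampliation_last [DecidableEq e] {k : ℕ} (M : Matrix (d × e) (d × e) ℂ) :
    ampliation (Fin.last k) M = (M ⊗ₖ (1 : Matrix (Fin k → e) _ ℂ)).submatrix
      (splitLastLeft d e k) (splitLastLeft d e k) := by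
  ext x y
  simp only [ampliation, splitLastLeft, Matrix.of_apply, Matrix.submatrix_apply,
    Matrix.kroneckerMap_apply, Matrix.one_apply, Equiv.coe_fn_mk, mul_ite, mul_one, mul_zero,
    Fin.forall_fin_succ', ne_eq, funext_iff, not_true_eq_false, false_imp_iff, and_true]
  have : ∀ j : Fin k, j.castSucc ≠ Fin.last k := Fin.castSucc_ne_last
  simp [this]

variable [Fintype d]

theorem partialTrace_kronecker_one_mul [DecidableEq c] (M : Matrix d d ℂ)
    (X : Matrix (d × c) (d × c) ℂ) :
    partialTrace ((M ⊗ₖ (1 : Matrix c c ℂ)) * X) = M * partialTrace X := by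
  ext a b
  simp only [partialTrace, Matrix.of_apply, Matrix.mul_apply, Fintype.sum_prod_type,
    Matrix.kroneckerMap_apply, Matrix.one_apply, mul_ite, mul_one, mul_zero, ite_mul, zero_mul,
    Finset.sum_ite_eq, Finset.mem_univ, if_true, Finset.mul_sum]
  exact Finset.sum_comm

theorem partialTrace_mul_kronecker_one [DecidableEq c] (M : Matrix d d ℂ)
    (X : Matrix (d × c) (d × c) ℂ) :
    partialTrace (X * (M ⊗ₖ (1 : Matrix c c ℂ))) = partialTrace X * M := by
  ext a b
  simp only [partialTrace, Matrix.of_apply, Matrix.mul_apply, Fintype.sum_prod_type,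
    Matrix.kroneckerMap_apply, Matrix.one_apply, mul_ite, mul_one, mul_zero,
    Finset.sum_ite_eq', Finset.mem_univ, if_true, Finset.sum_mul]
  exact Finset.sum_comm

theorem trace_partialTrace (W : Matrix (d × c) (d × c) ℂ) : (partialTrace W).trace = W.trace := by
  simp [partialTrace, Matrix.trace, Fintype.sum_prod_type]

variable [DecidableEq d] [DecidableEq e] [Fintype e]

/-- Tracing out the earlier copies commutes with an operator that acts only on `H₀` and the last
copy. -/
theorem partialTrace_ampliation_last_conj {k : ℕ} (M : Matrix (d × e) (d × e) ℂ)
    (T : Matrix (d × (Fin k → e)) (d × (Fin k → e)) ℂ) (β : Matrix e e ℂ) :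
    partialTrace (ampliation (Fin.last k) M *
      (T ⊗ₖ β).submatrix (splitLast d e k) (splitLast d e k) * (ampliation (Fin.last k) M)ᴴ) =
      partialTrace (M * (partialTrace T ⊗ₖ β) * Mᴴ) := by
  let X : Matrix ((d × e) × (Fin k → e)) ((d × e) × (Fin k → e)) ℂ :=
    Matrix.of fun u v => T (u.1.1, u.2) (v.1.1, v.2) * β u.1.2 v.1.2
  have h1 : (T ⊗ₖ β).submatrix (splitLast d e k) (splitLast d e k) =
      X.submatrix (splitLastLeft d e k) (splitLastLeft d e k) := rfl
  have h2 : partialTrace X = partialTrace T ⊗ₖ β := by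
    ext u v
    simp [X, partialTrace, Matrix.kroneckerMap_apply, Finset.sum_mul]
  rw [h1, ← ampliation_conjTranspose, ampliation_last, ampliation_last,
    Matrix.submatrix_mul_equiv, Matrix.submatrix_mul_equiv, partialTrace_submatrix_splitLastLeft,
    partialTrace_mul_kronecker_one, partialTrace_kronecker_one_mul, h2]

/-- The vacuum selects the column `x₀` of blocks, and the remaining sum over `z` is the Kraus form
of the transition. -/
theorem partialTrace_conj_vacuum (U : Matrix (d × e) (d × e) ℂ) (P : Matrix e e ℂ)
    (σ : Matrix d d ℂ) (x₀ : e) :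
    partialTrace (((1 : Matrix d d ℂ) ⊗ₖ P * U) * (σ ⊗ₖ vacuum x₀) *
      ((1 : Matrix d d ℂ) ⊗ₖ P * U)ᴴ) = transition (fun j => block U j x₀) P σ := by
  have h1 : ∀ (M : Matrix (d × e) (d × e) ℂ) a b z, (M * (σ ⊗ₖ vacuum x₀) * Mᴴ) (a, z) (b, z) =
      (block M z x₀ * σ * (block M z x₀)ᴴ) a b := by
    intro M a b z
    simp [Matrix.mul_apply, Fintype.sum_prod_type, Matrix.kroneckerMap_apply, vacuum,
      Matrix.single_apply, block, ite_and]
  have h2 : ∀ z, block ((1 : Matrix d d ℂ) ⊗ₖ P * U) z x₀ = ∑ j, P z j • block U j x₀ := by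
    intro z
    ext a b
    simp [Matrix.mul_apply, Fintype.sum_prod_type, Matrix.kroneckerMap_apply, block,
      Matrix.sum_apply, Matrix.one_apply]
  ext a b
  simp only [partialTrace, Matrix.of_apply, h1, h2, transition, Matrix.sum_apply]

variable {ι : Type*}

/-- Earlier projectors commute with the last interaction, so measuring after all the interactions
agrees with measuring after each one. -/
theorem unnormalizedState_snoc (U : Matrix (d × e) (d × e) ℂ) (β : Matrix e e ℂ)
    {P : ι → Matrix e e ℂ} (hP : ∀ i, (P i).IsHermitian) (ρ : Matrix d d ℂ) {k : ℕ}
    (i : Fin k → ι) (a : ι) :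
    unnormalizedState U β P ρ (Fin.snoc i a : Fin (k + 1) → ι) =
      ampliation (Fin.last k) ((1 : Matrix d d ℂ) ⊗ₖ P a * U) *
        (unnormalizedState U β P ρ i ⊗ₖ β).submatrix (splitLast d e k) (splitLast d e k) *
          (ampliation (Fin.last k) ((1 : Matrix d d ℂ) ⊗ₖ P a * U))ᴴ := by
  set W := projectorProd d P i * evolution U k with hW
  have hA : projectorProd d P (Fin.snoc i a : Fin (k + 1) → ι) * evolution U (k + 1) =
      ampliation (Fin.last k) ((1 : Matrix d d ℂ) ⊗ₖ P a * U) * extend W := by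
    rw [projectorProd_succ, evolution_succ, Fin.snoc_last]
    simp only [Fin.snoc_castSucc]
    rw [hW, extend_mul, mul_assoc, ← mul_assoc (extend _), extend_projectorProd_comm,
      ampliation_mul, ampliatedProjector]
    simp only [mul_assoc]
  have hE : extend W * initialState β ρ (k + 1) * (extend W)ᴴ =
      (unnormalizedState U β P ρ i ⊗ₖ β).submatrix (splitLast d e k) (splitLast d e k) := by
    rw [← extend_conjTranspose, initialState_succ, unnormalizedState_eq U β hP]
    simp only [extend, Matrix.submatrix_mul_equiv]
    rw [← Matrix.mul_kronecker_mul, ← Matrix.mul_kronecker_mul, one_mul, mul_one]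
  rw [unnormalizedState_eq U β hP, hA, Matrix.conjTranspose_mul, ← hE]
  simp only [mul_assoc]

/-- The non-normalized state of `H₀` evolves by the transitions. -/
theorem partialTrace_unnormalizedState_snoc (U : Matrix (d × e) (d × e) ℂ) (x₀ : e)
    {P : ι → Matrix e e ℂ} (hP : ∀ i, (P i).IsHermitian) (ρ : Matrix d d ℂ) {k : ℕ}
    (i : Fin k → ι) (a : ι) :
    partialTrace (unnormalizedState U (vacuum x₀) P ρ (Fin.snoc i a : Fin (k + 1) → ι)) =
      transition (fun j => block U j x₀) (P a)
        (partialTrace (unnormalizedState U (vacuum x₀) P ρ i)) := by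
  rw [unnormalizedState_snoc U _ hP, partialTrace_ampliation_last_conj, partialTrace_conj_vacuum]

theorem partialTrace_unnormalizedState_zero (U : Matrix (d × e) (d × e) ℂ) (β : Matrix e e ℂ)
    (P : ι → Matrix e e ℂ) (ρ : Matrix d d ℂ) (i : Fin 0 → ι) :
    partialTrace (unnormalizedState U β P ρ i) = ρ := by
  ext a b
  simp [partialTrace, unnormalizedState, evolution, initialState]

theorem posSemidef_partialTrace_unnormalizedState (U : Matrix (d × e) (d × e) ℂ) (x₀ : e)
    {P : ι → Matrix e e ℂ} (hP : ∀ i, (P i).IsHermitian) {ρ : Matrix d d ℂ} (hρ : ρ.PosSemidef)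
    {k : ℕ} (i : Fin k → ι) :
    (partialTrace (unnormalizedState U (vacuum x₀) P ρ i)).PosSemidef := by
  induction k with
  | zero => rwa [partialTrace_unnormalizedState_zero]
  | succ k ih =>
    rw [← Fin.snoc_init_self i]
    have := partialTrace_unnormalizedState_snoc U x₀ hP ρ (Fin.init i) (i (Fin.last k))
    exact this ▸ transition_posSemidef _ _ (ih _)

end PartialTrace

/-! ### Expectations as sums over words, and the increments of the trajectory -/

section OutcomeLaw

variable {d e ι : Type*} [Fintype d] [DecidableEq d] [Fintype e] [DecidableEq e]

/-- An outcome sequence with prescribed first terms. -/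
noncomputable def extendWord [Nonempty ι] {k : ℕ} (i : Fin k → ι) : ℕ → ι := fun j =>
  if hj : j < k then i ⟨j, hj⟩ else Classical.arbitrary ι

theorem extendWord_apply [Nonempty ι] {k : ℕ} (i : Fin k → ι) (j : Fin k) :
    extendWord i j = i j := by
  simp [extendWord]

theorem KnownAt.extendWord_snoc [Nonempty ι] {β : Type*} {k : ℕ} {f : (ℕ → ι) → β}
    (hf : KnownAt k f) (i : Fin k → ι) (a : ι) :
    f (extendWord (Fin.snoc i a : Fin (k + 1) → ι)) = f (extendWord i) := by
  refine hf fun j hj => ?_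
  have hj' : j < k := hj
  have h1 := extendWord_apply (Fin.snoc i a : Fin (k + 1) → ι) (Fin.castSucc ⟨j, hj'⟩)
  have h2 := extendWord_apply i ⟨j, hj'⟩
  rw [Fin.snoc_castSucc] at h1
  exact h1.trans h2.symm

variable {U : Matrix (d × e) (d × e) ℂ} {β : Matrix e e ℂ} {P : ι → Matrix e e ℂ}
  {ρ : Matrix d d ℂ}

theorem knownAt_trajectory (k : ℕ) : KnownAt k fun ω => trajectory U β P ρ ω k := by
  intro ω ω' h
  have : (fun j : Fin k => ω j) = fun j : Fin k => ω' j := funext fun j => h j j.2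
  simp only [trajectory, this]

theorem trajectory_eq (ω : ℕ → ι) (k : ℕ) : trajectory U β P ρ ω k =
    (partialTrace (unnormalizedState U β P ρ fun j : Fin k => ω j)).trace⁻¹ •
      partialTrace (unnormalizedState U β P ρ fun j : Fin k => ω j) := by
  rw [trajectory, partialTrace_smul, trace_partialTrace]

variable [MeasurableSpace ι] {Q : Measure (ℕ → ι)}

theorem IsOutcomeLaw.isProbabilityMeasure (hQ : IsOutcomeLaw U β P ρ Q) (hρ : ρ.trace = 1) :
    IsProbabilityMeasure Q := by
  constructor
  have := hQ 0 Fin.elim0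
  rw [← trace_partialTrace, partialTrace_unnormalizedState_zero, hρ] at this
  simpa using this

variable [Fintype ι] [Nonempty ι] [MeasurableSingletonClass ι]

/-- The expectation of a function of the first `k` outcomes. -/
theorem IsOutcomeLaw.integral_eq (hQ : IsOutcomeLaw U β P ρ Q) (hβ : β.PosSemidef)
    (hP : ∀ i, (P i).IsHermitian) (hρ : IsState ρ) {k : ℕ} {f : (ℕ → ι) → ℝ} (hf : KnownAt k f) :
    ∫ ω, f ω ∂Q = ∑ i : Fin k → ι,
      (partialTrace (unnormalizedState U β P ρ i)).trace.re * f (extendWord i) := by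
  have := hQ.isProbabilityMeasure hρ.2
  have hm : Measurable fun (ω : ℕ → ι) (j : Fin k) => ω j := by fun_prop
  have hf' : f = (fun i : Fin k → ι => f (extendWord i)) ∘ fun ω j => ω (j : Fin k) := by
    funext ω
    refine hf fun j hj => ?_
    exact (extendWord_apply (fun j : Fin k => ω j) ⟨j, hj⟩).symm
  have hg : Measurable fun i : Fin k → ι => f (extendWord i) := measurable_of_finite _
  have := Measure.isProbabilityMeasure_map (μ := Q) hm.aemeasurable
  conv_lhs => rw [hf']
  simp only [Function.comp_apply]
  rw [← integral_map (φ := fun (ω : ℕ → ι) (j : Fin k) => ω j) hm.aemeasurable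
    hg.aestronglyMeasurable, integral_fintype Integrable.of_finite]
  refine Finset.sum_congr rfl fun i _ => ?_
  rw [smul_eq_mul, measureReal_def, Measure.map_apply hm (measurableSet_singleton i)]
  have hset : (fun (ω : ℕ → ι) (j : Fin k) => ω j) ⁻¹' {i} = {ω | ∀ j : Fin k, ω j = i j} := by
    ext ω; simp [funext_iff]
  rw [hset, hQ, trace_partialTrace, ENNReal.toReal_ofReal]
  exact (Complex.le_def.1 (trace_unnormalizedState_nonneg hβ hP hρ.1 i)).1

/-- For weak interactions the quantum trajectories have small increments. -/
theorem exists_hasSmallIncrements_trajectory (x₀ : e) {c : ℝ} (hc : 0 ≤ c)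
    {P : ι → Matrix e e ℂ} (hP : ∀ a, (P a).IsHermitian) (hP2 : ∀ a, P a * P a = P a)
    (hP1 : ∑ a, P a = 1) :
    ∃ C : ℝ, 0 ≤ C ∧ ∀ (s : ℝ) (U : Matrix (d × e) (d × e) ℂ) (ρ : Matrix d d ℂ)
      (Q : Measure (ℕ → ι)), 0 ≤ s → s ≤ 1 → U ∈ Matrix.unitaryGroup (d × e) ℂ →
      IsWeak x₀ c s (fun j => block U j x₀) → IsState ρ →
      IsOutcomeLaw U (vacuum x₀) P ρ Q →
      HasSmallIncrements Q (trajectory U (vacuum x₀) P ρ) (C * s ^ 2) := by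
  obtain ⟨C, hC, hstep⟩ := exists_transition_step_bound (d := d) x₀ hc hP hP2 hP1
  refine ⟨C, hC, fun s U ρ Q hs0 hs1 hU hV hρ hQ => ⟨knownAt_trajectory, fun ω k => ?_, ?_⟩⟩
  · rw [trajectory_eq]
    exact PosSemidef.norm_inv_trace_smul_le
      (posSemidef_partialTrace_unnormalizedState U x₀ hP hρ.1 _)
  intro k f Y hf hY hf0 hY1
  set V : e → Matrix d d ℂ := fun j => block U j x₀ with hVdef
  let σ : ∀ {k : ℕ}, (Fin k → ι) → Matrix d d ℂ := fun {_} i =>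
    partialTrace (unnormalizedState U (vacuum x₀) P ρ i)
  have hσps : ∀ {k : ℕ} (i : Fin k → ι), (σ i).PosSemidef := fun i =>
    posSemidef_partialTrace_unnormalizedState U x₀ hP hρ.1 i
  have hσs : ∀ (i : Fin k → ι) a, σ (Fin.snoc i a : Fin (k + 1) → ι) = transition V (P a) (σ i) :=
    fun i a => partialTrace_unnormalizedState_snoc U x₀ hP ρ i a
  have hσt : ∀ i : Fin k → ι, ∑ a, (transition V (P a) (σ i)).trace = (σ i).trace := fun i => by
    simp only [← hσs, σ, trace_partialTrace]
    exact trace_unnormalizedState_succ hU (isState_vacuum x₀).2 hP hP2 hP1 ρ i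
  have htraj : ∀ {k : ℕ} (i : Fin k → ι),
      trajectory U (vacuum x₀) P ρ (extendWord i) k = (σ i).trace⁻¹ • σ i := fun i => by
    rw [trajectory_eq]
    simp only [extendWord_apply, σ]
  have hT := knownAt_trajectory (U := U) (β := vacuum x₀) (P := P) (ρ := ρ)
  rw [hQ.integral_eq (isState_vacuum x₀).1 hP hρ (k := k + 1)
      ((hf.mono k.le_succ).comp₂ ((hT (k + 1)).comp₂ (hY.mono k.le_succ) fun a b => ‖a - b‖ ^ 2)
        fun a b => a * b),
    hQ.integral_eq (isState_vacuum x₀).1 hP hρ (k := k)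
      (hf.comp₂ ((hT k).comp₂ hY fun a b => ‖a - b‖ ^ 2) fun a b => a * b),
    hQ.integral_eq (isState_vacuum x₀).1 hP hρ hf, Finset.mul_sum, ← Finset.sum_add_distrib,
    ← Fintype.sum_equiv (Fin.snocEquiv fun _ => ι) _ _ fun x => rfl, Fintype.sum_prod_type_right]
  -- The words of length `k + 1` are grouped by their prefix `i`, on which `f` and `Y` are constant;
  -- the inequality holds prefix by prefix.
  refine Finset.sum_le_sum fun i _ => ?_
  change ∑ a, (σ (Fin.snoc i a : Fin (k + 1) → ι)).trace.re *
    (f (extendWord (Fin.snoc i a : Fin (k + 1) → ι)) *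
      ‖trajectory U (vacuum x₀) P ρ (extendWord (Fin.snoc i a : Fin (k + 1) → ι)) (k + 1) -
        Y (extendWord (Fin.snoc i a : Fin (k + 1) → ι))‖ ^ 2) ≤ (σ i).trace.re *
    (f (extendWord i) * ‖trajectory U (vacuum x₀) P ρ (extendWord i) k - Y (extendWord i)‖ ^ 2) +
    C * s ^ 2 * ((σ i).trace.re * f (extendWord i))
  simp only [hf.extendWord_snoc, hY.extendWord_snoc, htraj, hσs]
  set q := (σ i).trace.re with hq
  have hqt : (q : ℂ) = (σ i).trace := PosSemidef.ofReal_re_trace (hσps i)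
  have hq0 : 0 ≤ q := (Complex.le_def.1 (hσps i).trace_nonneg).1
  set R : Matrix d d ℂ := (σ i).trace⁻¹ • σ i with hR
  have hσR : σ i = (q : ℂ) • R := by
    rw [hqt, hR, PosSemidef.trace_smul_inv_smul (hσps i)]
  have htr : ∀ a, transition V (P a) (σ i) = (q : ℂ) • transition V (P a) R := fun a => by
    rw [hσR, transition_smul]
  -- A prefix of probability zero contributes nothing. Otherwise the state is normalized, and
  -- unitarity, through `hσt`, makes the probabilities of the next outcomes add up to one.
  rcases hq0.eq_or_lt with hq00 | hq00
  · simp [htr, ← hq00]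
  · have hqc : (q : ℂ) ≠ 0 := by exact_mod_cast hq00.ne'
    have hRs : IsState R := by
      refine ⟨(hσps i).smul ?_, ?_⟩
      · rw [← hqt, ← Complex.ofReal_inv]
        exact_mod_cast inv_nonneg.2 hq0
      · rw [hR, Matrix.trace_smul, smul_eq_mul, ← hqt, inv_mul_cancel₀ hqc]
    have hsum : ∑ a, (transition V (P a) R).trace.re = 1 := by
      have h1 := hσt i
      simp only [htr, Matrix.trace_smul, smul_eq_mul, ← Finset.mul_sum, ← hqt] at h1
      have h2 := mul_left_cancel₀ hqc (h1.trans (mul_one _).symm)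
      rw [← Complex.re_sum, h2, Complex.one_re]
    have h1 := hstep s V R (Y (extendWord i)) hs0 hs1 hV hRs (hY1 _) hsum
    have h2 : ∀ a, (transition V (P a) (σ i)).trace⁻¹ • transition V (P a) (σ i) =
        (transition V (P a) R).trace⁻¹ • transition V (P a) R := fun a => by
      rw [htr, Matrix.trace_smul, smul_eq_mul, smul_smul, mul_inv, mul_right_comm,
        inv_mul_cancel₀ hqc, one_mul]
    have h3 : ∀ a, (transition V (P a) (σ i)).trace.re = q * (transition V (P a) R).trace.re :=
      fun a => by rw [htr, Matrix.trace_smul, smul_eq_mul, Complex.re_ofReal_mul]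
    simp only [h2, h3]
    have h4 : ∀ a, q * (transition V (P a) R).trace.re * (f (extendWord i) *
        ‖(transition V (P a) R).trace⁻¹ • transition V (P a) R - Y (extendWord i)‖ ^ 2) =
        q * f (extendWord i) * ((transition V (P a) R).trace.re *
        ‖(transition V (P a) R).trace⁻¹ • transition V (P a) R - Y (extendWord i)‖ ^ 2) :=
      fun a => by ring
    simp only [h4]
    rw [← Finset.mul_sum]
    have h5 := mul_le_mul_of_nonneg_left h1 (mul_nonneg hq0 (hf0 (extendWord i)))
    linarith

end OutcomeLaw

/-! ### Uniform bounds from the scaling hypotheses, and the main theorem -/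

theorem exists_norm_le_of_tendsto {E : Type*} [SeminormedAddCommGroup E] {u : ℕ → E} {a : E}
    (h : Tendsto u atTop (𝓝 a)) : ∃ c : ℝ, 0 ≤ c ∧ ∀ n, ‖u n‖ ≤ c := by
  obtain ⟨c, hc⟩ := (Metric.isBounded_range_of_tendsto u h).exists_norm_le
  have h0 := hc _ (Set.mem_range_self 0)
  exact ⟨c, (norm_nonneg _).trans h0, fun n => hc _ (Set.mem_range_self n)⟩

/-- The scaling of the blocks makes the interaction weak. -/
theorem exists_isWeak {d e : Type*} [Fintype d] [DecidableEq d] [Fintype e] {x₀ : e}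
    {V : ℕ → e → Matrix d d ℂ} {L : e → Matrix d d ℂ}
    (hL₀ : Tendsto (fun n : ℕ => (n : ℂ) • (V n x₀ - 1)) atTop (𝓝 (L x₀)))
    (hL : ∀ i, i ≠ x₀ →
      Tendsto (fun n : ℕ => ((Real.sqrt n : ℝ) : ℂ) • V n i) atTop (𝓝 (L i))) :
    ∃ c : ℝ, 0 ≤ c ∧ ∀ n : ℕ, 1 ≤ n → IsWeak x₀ c (Real.sqrt n)⁻¹ (V n) := by
  obtain ⟨c₀, hc₀, h₀⟩ := exists_norm_le_of_tendsto hL₀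
  have h : ∀ i, ∃ c : ℝ, 0 ≤ c ∧ (i ≠ x₀ → ∀ n : ℕ, ‖((Real.sqrt n : ℝ) : ℂ) • V n i‖ ≤ c) := by
    intro i
    by_cases hi : i = x₀
    · exact ⟨0, le_rfl, fun h => (h hi).elim⟩
    · obtain ⟨c, hc, hcn⟩ := exists_norm_le_of_tendsto (hL i hi)
      exact ⟨c, hc, fun _ => hcn⟩
  choose b hb0 hb using h
  have hbs : 0 ≤ ∑ i, b i := Finset.sum_nonneg fun i _ => hb0 i
  refine ⟨c₀ + ∑ i, b i, by positivity, fun n hn => ?_⟩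
  have hn0 : (0 : ℝ) < n := by exact_mod_cast hn
  have hs0 : 0 < Real.sqrt n := Real.sqrt_pos.2 hn0
  constructor
  · have h1 := h₀ n
    rw [norm_smul, Complex.norm_natCast] at h1
    rw [inv_pow, Real.sq_sqrt hn0.le, ← div_eq_mul_inv, le_div_iff₀ hn0]
    linarith
  · intro j hj
    have h1 := hb j hj n
    rw [norm_smul, Complex.norm_real, Real.norm_of_nonneg hs0.le] at h1
    rw [← div_eq_mul_inv, le_div_iff₀ hs0]
    have h2 : b j ≤ ∑ i, b i := Finset.single_le_sum (fun i _ => hb0 i) (Finset.mem_univ j)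
    linarith

end QTraj

/-- Moment bound and tightness for the discrete quantum trajectories `ρ_n(t) = ρ_[n t]`, `n ≥ 1`,
attached to the repeated measurement of `A = ∑ i, lam i • P i` with interaction times `1 / n`;
`‖·‖` is the Hilbert-Schmidt norm, the constant does not depend on the initial state, on `n` or on
the times, and tightness is that of the laws on the Skorokhod space of paths on `[0, ∞)`. -/
theorem proposition6 (K N p : ℕ)
    (U : ℕ → Matrix (Fin (K + 1) × Fin (N + 1)) (Fin (K + 1) × Fin (N + 1)) ℂ)
    (hU : ∀ n, U n ∈ Matrix.unitaryGroup (Fin (K + 1) × Fin (N + 1)) ℂ)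
    (L : Fin (N + 1) → Matrix (Fin (K + 1)) (Fin (K + 1)) ℂ)
    (hL₀ : Tendsto (fun n : ℕ => (n : ℂ) • (block (U n) 0 0 - 1)) atTop (𝓝 (L 0)))
    (hL : ∀ i, i ≠ 0 →
      Tendsto (fun n : ℕ => ((Real.sqrt n : ℝ) : ℂ) • block (U n) i 0) atTop (𝓝 (L i)))
    (A : Matrix (Fin (N + 1)) (Fin (N + 1)) ℂ) (lam : Fin (p + 1) → ℝ)
    (P : Fin (p + 1) → Matrix (Fin (N + 1)) (Fin (N + 1)) ℂ)
    (hP : IsSpectralDecomposition A lam P) :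
    ∃ Z : ℝ, ∀ (ρ₀ : Matrix (Fin (K + 1)) (Fin (K + 1)) ℂ) (hρ₀ : IsState ρ₀),
      (∀ n : ℕ, 1 ≤ n → ∀ t₁ t t₂ : ℝ≥0, t₁ < t → t < t₂ →
        Integrable (fun ω =>
          ‖(trajectoryPath n (U n) (vacuum 0) P ρ₀ ω).toFun t₂ -
              (trajectoryPath n (U n) (vacuum 0) P ρ₀ ω).toFun t‖ ^ 2 *
            ‖(trajectoryPath n (U n) (vacuum 0) P ρ₀ ω).toFun t -
              (trajectoryPath n (U n) (vacuum 0) P ρ₀ ω).toFun t₁‖ ^ 2)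
          (outcomeLaw (hU n) (isState_vacuum 0) hP hρ₀) ∧
        ∫ ω, ‖(trajectoryPath n (U n) (vacuum 0) P ρ₀ ω).toFun t₂ -
              (trajectoryPath n (U n) (vacuum 0) P ρ₀ ω).toFun t‖ ^ 2 *
            ‖(trajectoryPath n (U n) (vacuum 0) P ρ₀ ω).toFun t -
              (trajectoryPath n (U n) (vacuum 0) P ρ₀ ω).toFun t₁‖ ^ 2
          ∂(outcomeLaw (hU n) (isState_vacuum 0) hP hρ₀) ≤ Z * ((t₂ : ℝ) - t₁) ^ 2) ∧
      (∀ n : ℕ, 1 ≤ n → Measurable (trajectoryPath n (U n) (vacuum 0) P ρ₀)) ∧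
      IsTightMeasureSet {μ | ∃ n : ℕ, 1 ≤ n ∧
        μ = (outcomeLaw (hU n) (isState_vacuum 0) hP hρ₀).map
          (trajectoryPath n (U n) (vacuum 0) P ρ₀)} := by
  obtain ⟨c, hc, hweak⟩ := exists_isWeak (x₀ := 0) (V := fun n j => block (U n) j 0) hL₀ hL
  -- The constant is fixed before the initial state and `n`. The strength is `s = 1 / √n`, so `C * s
  -- ^ 2` is `C / n`, and `Z = C ^ 2` works.
  obtain ⟨C, hC, hsmall⟩ := exists_hasSmallIncrements_trajectory (d := Fin (K + 1)) 0 hc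
    hP.hermitian hP.idempotent hP.sum_eq_one
  refine ⟨C ^ 2, fun ρ₀ hρ₀ => ?_⟩
  have hlaw := fun n => isOutcomeLaw_outcomeLaw (hU n) (isState_vacuum 0) hP hρ₀
  have hprob : ∀ n, IsProbabilityMeasure (outcomeLaw (hU n) (isState_vacuum 0) hP hρ₀) :=
    fun n => (hlaw n).isProbabilityMeasure hρ₀.2
  have hX : ∀ n : ℕ, 1 ≤ n → HasSmallIncrements (outcomeLaw (hU n) (isState_vacuum 0) hP hρ₀)
      (trajectory (U n) (vacuum 0) P ρ₀) (C / n) := by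
    intro n hn
    have hn1 : (1 : ℝ) ≤ n := by exact_mod_cast hn
    have h := hsmall (Real.sqrt n)⁻¹ (U n) ρ₀ _ (by positivity)
      (inv_le_one_of_one_le₀ (Real.one_le_sqrt.2 hn1)) (hU n) (hweak n hn) hρ₀ (hlaw n)
    rwa [inv_pow, Real.sq_sqrt (by positivity), ← div_eq_mul_inv] at h
  refine ⟨fun n hn t₁ t t₂ h₁ h₂ => ⟨?_, ?_⟩, fun n hn => ?_, ?_⟩
  · have hprob := hprob n
    have hk := (hX n hn).knownAt
    have hmono : ∀ s : ℝ≥0, s ≤ t₂ → KnownAt ⌊(n : ℝ≥0) * t₂⌋₊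
        fun ω => (trajectoryPath n (U n) (vacuum 0) P ρ₀ ω).toFun s := fun s hs =>
      (hk ⌊(n : ℝ≥0) * s⌋₊).mono (Nat.floor_mono (by gcongr))
    exact KnownAt.integrable (((hmono t₂ le_rfl).comp₂ (hmono t h₂.le) fun a b => ‖a - b‖ ^ 2).comp₂
      ((hmono t h₂.le).comp₂ (hmono t₁ (h₁.trans h₂).le) fun a b => ‖a - b‖ ^ 2)
      fun a b => a * b) _
  · have hprob := hprob n
    exact (hX n hn).integral_stepPath_le hC hn h₁ h₂
  · exact measurable_stepPath (hX n hn).knownAt n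
  · have : ProperSpace (Matrix (Fin (K + 1)) (Fin (K + 1)) ℂ) := FiniteDimensional.proper ℂ _
    exact isTightMeasureSet_stepPath hC (fun n _ => hprob n) hX
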